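/- Let $\mathsf{M}$ be a loopless matroid of rank $k$ on a finite ground set $E$ of size $n$, and let $\mathcal{L}(\mathsf{M})$ be its lattice of flats. The Chow ring of $\mathsf{M}$ is the graded ring \[ \underline{\mathrm{CH}}(\mathsf{M}) = \mathbb{Q}\bigl[x_F : F\in\mathcal{L}(\mathsf{M})\smallsetminus\{\varnothing,E\}\bigr]\big/(I+J), \] where $I$ is generated by the products $x_{F}x_{G}$ with $F,G$ incomparable and $J$ is generated by the elements $\sum_{F\ni i}x_F-\sum_{F\ni j}x_F$ with $i,j\in E$. The augmented Chow ring of $\mathsf{M}$ is the graded ring \[ \mathrm{CH}(\mathsf{M}) = \mathbb{Q}\bigl[x_F,\,y_i : F\in\mathcal{L}(\mathsf{M})\smallsetminus\{E\},\ i\in E\bigr]\big/(I'+J'), \] where $I'$ is generated by the elements $y_i-\sum_{F\not\ni i}x_F$ with $i\in E$, and $J'$ is generated by the products $x_{F}x_{G}$ with $F,G$ incomparable and the products $y_ix_F$ with $i\notin F$. All variables have degree $1$. Let \[ \underline{\mathrm{H}}_{\mathsf{M}}(x)=\sum_{j\ge 0}\dim_{\mathbb{Q}}\underline{\mathrm{CH}}^j(\mathsf{M})\,x^j,\qquad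 \mathrm{H}_{\mathsf{M}}(x)=\sum_{j\ge 0}\dim_{\mathbb{Q}}\mathrm{CH}^j(\mathsf{M})\,x^j \] be their Hilbert--Poincar\'e series. Let $\mathsf{U}_{k,n}$ be the uniform matroid on $[n]$ whose bases are the $k$-element subsets of $[n]$. For series $A,B$ with integer coefficients write $A\preceq B$ if $B-A$ has nonnegative coefficients. Then \[ \underline{\mathrm{H}}_{\mathsf{M}}(x)\preceq \underline{\mathrm{H}}_{\mathsf{U}_{k,n}}(x)\qquad\text{and}\qquad \mathrm{H}_{\mathsf{M}}(x)\preceq \mathrm{H}_{\mathsf{U}_{k,n}}(x). \] -/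

import Mathlib

noncomputable section

namespace Matroid

/-! ### Uniform matroids -/

/-- The uniform matroid `U_{k,n}` on the ground set `Fin n`: the independent sets are the sets with
at most `k` elements. (It has rank `k` when `k ≤ n`.) -/
def uniform (k n : ℕ) : Matroid (Fin n) :=
  (IndepMatroid.ofFinite (E := Set.univ) Set.finite_univ (fun I : Set (Fin n) => I.ncard ≤ k)
    (by simp)
    (fun _ _ hJ hIJ => (Set.ncard_le_ncard hIJ (Set.toFinite _)).trans hJ)
    (by
      intro I J _ hJ hIJ
      obtain ⟨e, heJ, heI⟩ := Set.exists_mem_notMem_of_ncard_lt_ncard hIJ (Set.toFinite _)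
      refine ⟨e, heJ, heI, ?_⟩
      rw [Set.ncard_insert_of_notMem heI (Set.toFinite _)]
      omega)
    (fun _ _ => Set.subset_univ _)).matroid

@[simp] theorem uniform_ground (k n : ℕ) : (uniform k n).E = Set.univ := rfl

@[simp] theorem uniform_indep_iff {k n : ℕ} {I : Set (Fin n)} :
    (uniform k n).Indep I ↔ I.ncard ≤ k := Iff.rfl

instance uniform_finite (k n : ℕ) : (uniform k n).Finite := ⟨Set.toFinite _⟩

/-- For `k ≤ n` the bases of `U_{k,n}` are exactly the `k`-element subsets of the ground set. -/
theorem uniform_isBase_iff {k n : ℕ} (hkn : k ≤ n) {B : Set (Fin n)} :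
    (uniform k n).IsBase B ↔ B.ncard = k := by
  rw [isBase_iff_maximal_indep]
  constructor
  · rintro ⟨hB, hmax⟩
    have hB' : B.ncard ≤ k := hB
    by_contra hne
    have hlt : B.ncard < (Set.univ : Set (Fin n)).ncard := by
      rw [Set.ncard_univ, Nat.card_fin]; omega
    obtain ⟨e, -, he⟩ := Set.exists_mem_notMem_of_ncard_lt_ncard hlt (Set.toFinite _)
    have hins : (uniform k n).Indep (insert e B) := by
      rw [uniform_indep_iff, Set.ncard_insert_of_notMem he (Set.toFinite _)]
      omega
    exact he (hmax hins (Set.subset_insert e B) (Set.mem_insert e B))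
  · intro hB
    refine ⟨hB.le, fun J hJ hBJ => ?_⟩
    have hJ' : J.ncard ≤ k := hJ
    exact (Set.eq_of_subset_of_ncard_le hBJ (by omega) (Set.toFinite _)).ge

/-! ### Graded quotients of polynomial rings -/

/-- The degree `j` piece of the quotient `ℚ[x_s : s ∈ σ] / I`: the image of the space of homogeneous
polynomials of degree `j`. -/
def quotientPiece {σ : Type*} (I : Ideal (MvPolynomial σ ℚ)) (j : ℕ) :
    Submodule ℚ (MvPolynomial σ ℚ ⧸ I) :=
  (MvPolynomial.homogeneousSubmodule σ ℚ j).map (Ideal.Quotient.mkₐ ℚ I).toLinearMap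

/-- The Hilbert–Poincaré series `∑_j dim_ℚ (R_j) x^j` of `R = ℚ[x_s : s ∈ σ] / I`. -/
def hilbertSeries {σ : Type*} (I : Ideal (MvPolynomial σ ℚ)) : PowerSeries ℤ :=
  PowerSeries.mk fun j => (Module.finrank ℚ (quotientPiece I j) : ℤ)

/-- `A ⪯ B`: the difference `B - A` has nonnegative coefficients. -/
def CoeffLE (A B : PowerSeries ℤ) : Prop := ∀ j : ℕ, 0 ≤ PowerSeries.coeff j (B - A)

variable {α : Type*}

/-! ### The Chow ring -/

/-- Flats different from the ground set `E`, ordered by inclusion. -/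
abbrev ProperFlat (M : Matroid α) : Type _ := {F : Set α // M.IsFlat F ∧ F ≠ M.E}

/-- Flats different from `∅` and from the ground set `E`, ordered by inclusion. -/
abbrev NonemptyProperFlat (M : Matroid α) : Type _ :=
  {F : Set α // M.IsFlat F ∧ F ≠ ∅ ∧ F ≠ M.E}

instance (M : Matroid α) [M.Finite] : Fintype M.ProperFlat :=
  ((M.ground_finite.finite_subsets).subset fun _ hF => hF.1.subset_ground).fintype

instance (M : Matroid α) [M.Finite] : Fintype M.NonemptyProperFlat :=
  ((M.ground_finite.finite_subsets).subset fun _ hF => hF.1.subset_ground).fintype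

open scoped Classical in
/-- `∑_{F ∋ i} x_F`, over the flats `F ≠ ∅, E` that contain `i`. -/
def sumContaining (M : Matroid α) [M.Finite] (i : α) : MvPolynomial M.NonemptyProperFlat ℚ :=
  ∑ F : M.NonemptyProperFlat with i ∈ F.1, MvPolynomial.X F

/-- The defining ideal of the Chow ring, generated by the products `x_F x_G` for `F`, `G`
incomparable and by the differences `∑_{F ∋ i} x_F - ∑_{F ∋ j} x_F` for `i, j ∈ E`. -/
def chowIdeal (M : Matroid α) [M.Finite] : Ideal (MvPolynomial M.NonemptyProperFlat ℚ) :=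
  Ideal.span {p | ∃ F G : M.NonemptyProperFlat, ¬ F.1 ⊆ G.1 ∧ ¬ G.1 ⊆ F.1 ∧
      p = MvPolynomial.X F * MvPolynomial.X G} ⊔
  Ideal.span {p | ∃ i ∈ M.E, ∃ j ∈ M.E, p = M.sumContaining i - M.sumContaining j}

/-- The Chow ring of `M`. -/
abbrev ChowRing (M : Matroid α) [M.Finite] : Type _ :=
  MvPolynomial M.NonemptyProperFlat ℚ ⧸ M.chowIdeal

/-- The Hilbert–Poincaré series of the Chow ring of `M`. -/
def chowSeries (M : Matroid α) [M.Finite] : PowerSeries ℤ := hilbertSeries M.chowIdeal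

/-! ### The augmented Chow ring -/

/-- The variables of the augmented Chow ring: `x_F` (`Sum.inl F`) for the flats `F ≠ E`,
and `y_i` (`Sum.inr i`) for `i ∈ E`. -/
abbrev AugVar (M : Matroid α) : Type _ := M.ProperFlat ⊕ M.E

/-- The variable `x_F`. -/
def augX (M : Matroid α) (F : M.ProperFlat) : MvPolynomial M.AugVar ℚ :=
  MvPolynomial.X (Sum.inl F)

/-- The variable `y_i`. -/
def augY (M : Matroid α) (i : M.E) : MvPolynomial M.AugVar ℚ :=
  MvPolynomial.X (Sum.inr i)

open scoped Classical in
/-- `∑_{F ∌ i} x_F`, over the flats `F ≠ E` that do not contain `i`. -/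
def augSumAvoiding (M : Matroid α) [M.Finite] (i : M.E) : MvPolynomial M.AugVar ℚ :=
  ∑ F : M.ProperFlat with i.1 ∉ F.1, M.augX F

/-- The defining ideal of the augmented Chow ring, generated by `y_i - ∑_{F ∌ i} x_F` for `i ∈ E`,
by `x_F x_G` for `F`, `G` incomparable, and by `y_i x_F` for `i ∉ F`. -/
def augChowIdeal (M : Matroid α) [M.Finite] : Ideal (MvPolynomial M.AugVar ℚ) :=
  Ideal.span {p | ∃ i : M.E, p = M.augY i - M.augSumAvoiding i} ⊔
  (Ideal.span {p | ∃ F G : M.ProperFlat, ¬ F.1 ⊆ G.1 ∧ ¬ G.1 ⊆ F.1 ∧ p = M.augX F * M.augX G} ⊔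
    Ideal.span {p | ∃ (i : M.E) (F : M.ProperFlat), i.1 ∉ F.1 ∧ p = M.augY i * M.augX F})

/-- The augmented Chow ring of `M`. -/
abbrev AugChowRing (M : Matroid α) [M.Finite] : Type _ :=
  MvPolynomial M.AugVar ℚ ⧸ M.augChowIdeal

/-- The Hilbert–Poincaré series of the augmented Chow ring of `M`. -/
def augChowSeries (M : Matroid α) [M.Finite] : PowerSeries ℤ := hilbertSeries M.augChowIdeal

end Matroid

end

/-!
The Chow ring and the augmented Chow ring are treated together. Add a new bottom element to the
lattice of flats of a loopless matroid, and give a flat `F` the rank `rk F + 1` and the new element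
the rank `0`. For an element `B` of this lattice let `A(B)` be the quotient of the polynomial ring
in the variables `x_G`, `G > B`, by the products `x_F x_G` for incomparable `F`, `G`, the powers
`h_G ^ (ρ G - ρ B)`, and the products `x_F h_G ^ (ρ G - ρ F)` for `F < G`, where `h_G = ∑_{H ≥ G}
x_H`. These relations follow from the ones where the exponent is `1` (`ChowBasis.relIdeal_Ioi_le`).
Hence `A(∅)` is the Chow ring (`ChowBasis.chowSeries_eq`): eliminating `x_E` from the relations `h_G
= 0`, for flats `G` of rank one, gives its linear relations. Likewise `A(⊥)` is the augmented Chow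
ring (`ChowBasis.augChowSeries_eq`): the relation `h_∅ = 0` eliminates `x_E`, and `y_i` is `- h_G`
for the flat `G` spanned by `i`.

The variables of `A(B)` are introduced one flat at a time, larger flats first. If `R` is the ring
obtained from a set `P` of flats and `F` is the next one, the new ring is `R[T]` modulo
`T J` and `(T + s) ^ r`, where `T = x_F`, `s = ∑_{H > F} x_H`, `r = ρ F - ρ B` and `R / J = A(F)`.
Submodularity of the rank gives `s ^ r J = 0` (`ChowBasis.mul_pow_mem_of_mem_relIdeal_Ioi`), and it
follows that the new ring is `R ⊕ ⨁_{1 ≤ i < r} A(F) T ^ i`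
(`ChowBasis.coeff_mem_of_mem_sup`, `ChowBasis.HasGradedBasis.insert`). Therefore the Hilbert series
satisfy `H(B) = 1 + ∑_{F > B} (x + ⋯ + x ^ (ρ F - ρ B - 1)) H(F)` (`ChowBasis.fyPoly_eq`,
`ChowBasis.hasGradedBasis_Ioi`), so that they grow with the numbers of flats of each rank.

It remains to compare numbers of flats. If `F` and `F'` are flats of the same rank in `M` and in
the uniform matroid, the flats above `F` inject, with their ranks, into the flats above `F'`: extend
a fixed basis of `F` to bases of the flats above it, and use that in the uniform matroid every set
with fewer than `k` elements is a flat (`ChowBasis.exists_injOn_flats`). The recursion then gives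
the inequality of coefficients (`ChowBasis.coeff_fyPoly_le`).
-/

/-! ### The relations on a finite join-semilattice with a rank function -/

namespace ChowBasis

open MvPolynomial

/-- A rank function on a finite join-semilattice of flats: strictly monotone, submodular on upper
intervals (stated without meets), and growing by one along covers. -/
structure IsRank {L : Type*} [SemilatticeSup L] (ρ : L → ℕ) : Prop where
  strictMono : StrictMono ρ
  submodular : ∀ B G H, B ≤ G → B ≤ H → ρ (G ⊔ H) + ρ B ≤ ρ G + ρ H
  exists_succ : ∀ F G, F < G → ∃ F', F < F' ∧ F' ≤ G ∧ ρ F' = ρ F + 1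

section Ideal

variable {L : Type*} [SemilatticeSup L] [Fintype L]

open scoped Classical in
/-- The element `h_G = ∑_{H ≥ G} x_H`. -/
noncomputable def hsum (G : L) : MvPolynomial L ℚ := ∑ H with G ≤ H, X H

/-- The relations among the variables `x_G` with `G ∈ P`, relative to a base element `B` below `P`.
The polynomial ring has a variable for every element of `L`, whatever `B` and `P` are, and the
variables outside `P` are set to zero. The relations `base` are what `pair` would say for `F = B`
if `x_B` were `1`. -/
inductive ChowRel (ρ : L → ℕ) (B : L) (P : Set L) : MvPolynomial L ℚ → Prop
  | var (G : L) (hG : G ∉ P) : ChowRel ρ B P (X G)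
  | incomp (F G : L) (h₁ : ¬ F ≤ G) (h₂ : ¬ G ≤ F) : ChowRel ρ B P (X F * X G)
  | base (G : L) (hG : G ∈ P) : ChowRel ρ B P (hsum G ^ (ρ G - ρ B))
  | pair (F G : L) (hF : F ∈ P) (hG : G ∈ P) (hFG : F < G) :
      ChowRel ρ B P (X F * hsum G ^ (ρ G - ρ F))

/-- The ideal generated by the relations `ChowRel`. -/
noncomputable def relIdeal (ρ : L → ℕ) (B : L) (P : Set L) : Ideal (MvPolynomial L ℚ) :=
  Ideal.span {p | ChowRel ρ B P p}

variable {ρ : L → ℕ} {B : L} {P : Set L}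

theorem ChowRel.mem {p : MvPolynomial L ℚ} (h : ChowRel ρ B P p) : p ∈ relIdeal ρ B P :=
  Ideal.subset_span h

/-- If `a u = a v` modulo `I` then `a u ^ m ∈ I` as soon as `a v ^ m ∈ I`. -/
theorem mul_pow_mem_of_mul_sub_mem {R : Type*} [CommRing R] {I : Ideal R} {a u v : R} (m : ℕ)
    (h : a * (u - v) ∈ I) (hv : a * v ^ m ∈ I) : a * u ^ m ∈ I := by
  obtain ⟨c, hc⟩ := sub_dvd_pow_sub_pow u v m
  have : a * u ^ m = a * (u - v) * c + a * v ^ m := by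
    rw [mul_assoc, ← hc]; ring
  rw [this]
  exact I.add_mem (I.mul_mem_right _ h) hv

open scoped Classical in
/-- If `G ≤ G'` then `h_G - h_{G'}` is a sum of variables. -/
theorem hsum_sub_hsum {G G' : L} (h : G ≤ G') :
    hsum G - hsum G' = ∑ H with G ≤ H ∧ ¬ G' ≤ H, (X H : MvPolynomial L ℚ) := by
  rw [hsum, hsum, sub_eq_iff_eq_add, ← Finset.sum_filter_add_sum_filter_not
    (Finset.univ.filter (G ≤ ·)) (G' ≤ ·), add_comm, Finset.filter_filter, Finset.filter_filter]
  congr 1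
  refine Finset.sum_congr ?_ fun _ _ => rfl
  ext H
  simpa using fun h' => h.trans h'

/-- Multiplied by `x_H`, the element `h_G` only depends on `G ⊔ H`. -/
theorem X_mul_hsum_sub_mem (I : Ideal (MvPolynomial L ℚ))
    (hI : ∀ F G : L, ¬ F ≤ G → ¬ G ≤ F → (X F * X G : MvPolynomial L ℚ) ∈ I) {G H : L}
    (hGH : ¬ G ≤ H) : X H * (hsum G - hsum (G ⊔ H)) ∈ I := by
  classical
  rw [hsum_sub_hsum le_sup_left, Finset.mul_sum]
  refine I.sum_mem fun K hK => ?_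
  simp only [Finset.mem_filter, Finset.mem_univ, true_and, sup_le_iff, not_and] at hK
  exact hI _ _ (hK.2 hK.1) fun h => hGH (hK.1.trans h)

theorem pow_mem_of_le {R : Type*} [CommRing R] {I : Ideal R} {a x : R} {m n : ℕ} (hmn : m ≤ n)
    (h : a * x ^ m ∈ I) : a * x ^ n ∈ I := by
  rw [← Nat.sub_add_cancel hmn, pow_add, mul_comm (x ^ _), ← mul_assoc]
  exact I.mul_mem_right _ h

/-- The relation of the pair `H < G ⊔ H`, rewritten in terms of `G`. -/
theorem X_mul_hsum_pow_mem (hP : IsUpperSet P) {G H : L} (hH : H ∈ P) (hGH : ¬ G ≤ H) {m : ℕ}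
    (hm : ρ (G ⊔ H) ≤ ρ H + m) : X H * hsum G ^ m ∈ relIdeal ρ B P := by
  refine mul_pow_mem_of_mul_sub_mem m (X_mul_hsum_sub_mem _ (fun F G h₁ h₂ =>
    (ChowRel.incomp F G h₁ h₂).mem) hGH) ?_
  have hlt : H < G ⊔ H := lt_of_le_of_ne le_sup_right fun h => hGH (h ▸ le_sup_left)
  exact pow_mem_of_le (by omega) (ChowRel.pair H (G ⊔ H) hH (hP le_sup_right hH) hlt).mem

variable {F : L} (hρ : IsRank ρ) (hP : IsUpperSet P) (hPB : P ⊆ Set.Ioi B) (hB : B < F)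
  (hFP : F ∉ P) (hF : Set.Ioi F ⊆ P)

include hρ hP hPB hB hFP hF

/-- Enlarging the base to `F` and keeping only the elements above `F` imposes more relations. -/
theorem relIdeal_le_relIdeal_Ioi : relIdeal ρ B P ≤ relIdeal ρ F (Set.Ioi F) := by
  classical
  refine Ideal.span_le.2 ?_
  rintro p (⟨G, hG⟩ | ⟨G, H, h₁, h₂⟩ | ⟨G, hG⟩ | ⟨G, H, hG, hH, hGH⟩)
  · exact (ChowRel.var G fun h => hG (hF h)).mem
  · exact (ChowRel.incomp G H h₁ h₂).mem
  · have hGF : ¬ G ≤ F := fun h => hFP (hP h hG)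
    have hlt : F < G ⊔ F := lt_of_le_of_ne le_sup_right fun h => hGF (h ▸ le_sup_left)
    rw [← one_mul (hsum G ^ _)]
    refine mul_pow_mem_of_mul_sub_mem (v := hsum (G ⊔ F)) _ ?_ ?_
    · rw [one_mul, hsum_sub_hsum le_sup_left]
      refine Ideal.sum_mem _ fun K hK => (ChowRel.var K fun h => ?_).mem
      simp only [Finset.mem_filter, Finset.mem_univ, true_and, sup_le_iff, not_and] at hK
      exact hK.2 hK.1 (le_of_lt h)
    · refine pow_mem_of_le (m := ρ (G ⊔ F) - ρ F) ?_ ?_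
      · have := hρ.submodular B G F (hPB hG).le hB.le
        have := hρ.strictMono hB
        omega
      · rw [one_mul]
        exact (ChowRel.base _ hlt).mem
  · by_cases hFG : F < G
    · exact (ChowRel.pair G H hFG (hFG.trans hGH) hGH).mem
    · exact Ideal.mul_mem_right _ _ (ChowRel.var G hFG).mem

/-- The ideal attached to the base `F` annihilates `(∑_{H > F} x_H) ^ (ρ F - ρ B)` modulo the
ideal attached to `B`. -/
theorem mul_pow_mem_of_mem_relIdeal_Ioi {a : MvPolynomial L ℚ}
    (ha : a ∈ relIdeal ρ F (Set.Ioi F)) :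
    a * (hsum F - X F) ^ (ρ F - ρ B) ∈ relIdeal ρ B P := by
  classical
  have hXF : (X F : MvPolynomial L ℚ) ∈ relIdeal ρ B P := (ChowRel.var F hFP).mem
  have hs (c : MvPolynomial L ℚ) (h : c * hsum F ^ (ρ F - ρ B) ∈ relIdeal ρ B P) :
      c * (hsum F - X F) ^ (ρ F - ρ B) ∈ relIdeal ρ B P := by
    refine mul_pow_mem_of_mul_sub_mem _ (Ideal.mul_mem_left _ _ ?_) h
    simpa using hXF
  refine hs a ?_
  induction ha using Submodule.span_induction with
  | zero => simp
  | add x y _ _ hx hy => rw [add_mul]; exact Ideal.add_mem _ hx hy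
  | smul c x _ hx => rw [smul_eq_mul, mul_assoc]; exact Ideal.mul_mem_left _ _ hx
  | mem x hx =>
    rcases hx with ⟨G, hG⟩ | ⟨G, H, h₁, h₂⟩ | ⟨G, hG⟩ | ⟨G, H, hG, hH, hGH⟩
    · by_cases hGP : G ∈ P
      · have hFG : ¬ F ≤ G := fun h => hG (lt_of_le_of_ne h (by rintro rfl; exact hFP hGP))
        refine X_mul_hsum_pow_mem hP hGP hFG ?_
        have := hρ.submodular B F G hB.le (hPB hGP).le
        omega
      · exact Ideal.mul_mem_right _ _ (ChowRel.var G hGP).mem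
    · exact Ideal.mul_mem_right _ _ (ChowRel.incomp G H h₁ h₂).mem
    · have hFG : F < G := hG
      have h1 := hρ.strictMono hFG
      have h2 := hρ.strictMono hB
      refine mul_pow_mem_of_mul_sub_mem (v := hsum G) _ ?_ ?_
      · rw [hsum_sub_hsum hFG.le, Finset.mul_sum]
        refine Ideal.sum_mem _ fun K hK => ?_
        simp only [Finset.mem_filter, Finset.mem_univ, true_and] at hK
        by_cases hKP : K ∈ P
        · rw [mul_comm]
          refine X_mul_hsum_pow_mem hP hKP hK.2 ?_
          have := hρ.submodular F G K hFG.le hK.1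
          omega
        · exact Ideal.mul_mem_left _ _ (ChowRel.var K hKP).mem
      · rw [← pow_add, show ρ G - ρ F + (ρ F - ρ B) = ρ G - ρ B by omega]
        exact (ChowRel.base G (hF hG)).mem
    · exact Ideal.mul_mem_right _ _ (ChowRel.pair G H (hF hG) (hF hH) hGH).mem

end Ideal

end ChowBasis

/-! ### Graded bases of quotients and the effect of adding one flat -/

namespace ChowBasis

open MvPolynomial

/-- In `R[T]`, a polynomial of degree `< r` in the ideal `I[T] + T J[T] + ((T + s)^r)` has all its
coefficients in `J` and its constant coefficient in `I`, provided that `I ≤ J` and `s^r J ≤ I`. -/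
theorem coeff_mem_of_mem_sup {R : Type*} [CommRing R] {I J : Ideal R} {s : R} {r : ℕ} (hIJ : I ≤ J)
    (hs : ∀ a ∈ J, a * s ^ r ∈ I) {q : Polynomial R} (hq : q.natDegree < r)
    (hmem : q ∈ I.map Polynomial.C ⊔ Ideal.span {Polynomial.X} * J.map Polynomial.C ⊔
      Ideal.span {(Polynomial.X + Polynomial.C s) ^ r}) :
    q.coeff 0 ∈ I ∧ ∀ i, q.coeff i ∈ J := by
  obtain ⟨y, hy, z, hz, rfl⟩ := Submodule.mem_sup.1 hmem
  obtain ⟨u, hu, x, hx, rfl⟩ := Submodule.mem_sup.1 hy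
  obtain ⟨w, hw, rfl⟩ := Ideal.mem_span_singleton_mul.1 hx
  obtain ⟨v, rfl⟩ := Ideal.mem_span_singleton'.1 hz
  rw [Ideal.mem_map_C_iff] at hu hw
  set f := Polynomial.mapRingHom (Ideal.Quotient.mk J) with hf
  have hzero (p : Polynomial R) : f p = 0 ↔ ∀ n, p.coeff n ∈ J := by
    simp [hf, Polynomial.ext_iff, Ideal.Quotient.eq_zero_iff_mem]
  have hfu : f u = 0 := (hzero u).2 fun n => hIJ (hu n)
  have hfw : f w = 0 := (hzero w).2 hw
  have hfq : f (u + Polynomial.X * w + v * (Polynomial.X + Polynomial.C s) ^ r) =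
      f v * (Polynomial.X + Polynomial.C (Ideal.Quotient.mk J s)) ^ r := by
    rw [map_add, map_add, map_mul, hfu, hfw]
    simp [hf]
  -- A multiple of a monic polynomial of degree `r` has degree `< r` only if it vanishes.
  have hfv : f v = 0 := by
    by_contra hne
    have : Nontrivial (Polynomial (R ⧸ J)) := ⟨⟨_, _, hne⟩⟩
    have : Nontrivial (R ⧸ J) := Polynomial.nontrivial_iff.1 this
    have hmonic := (Polynomial.monic_X_add_C (Ideal.Quotient.mk J s)).pow r
    have hdeg := hmonic.natDegree_mul' hne
    rw [mul_comm, ← hfq, Polynomial.natDegree_pow_X_add_C] at hdeg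
    have : (f (u + Polynomial.X * w + v * (Polynomial.X + Polynomial.C s) ^ r)).natDegree < r :=
      lt_of_le_of_lt (by rw [hf, Polynomial.coe_mapRingHom]; exact Polynomial.natDegree_map_le) hq
    omega
  refine ⟨?_, (hzero _).1 (by rw [hfq, hfv, zero_mul])⟩
  have : (u + Polynomial.X * w + v * (Polynomial.X + Polynomial.C s) ^ r).coeff 0 =
      u.coeff 0 + v.coeff 0 * s ^ r := by
    simp [Polynomial.coeff_zero_eq_eval_zero]
  rw [this]
  exact I.add_mem (hu 0) (hs _ ((hzero v).1 hfv 0))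

/-- The quotient `ℚ[x_G : G ∈ L] / I` has a basis of homogeneous polynomials in the variables
indexed by `P`, which spans degree by degree, and `h` is the generating polynomial of the degrees
of the basis elements. -/
def HasGradedBasis {L : Type*} (I : Ideal (MvPolynomial L ℚ)) (P : Set L) (h : Polynomial ℕ) :
    Prop :=
  ∃ (ι : Type) (_ : Fintype ι) (b : ι → MvPolynomial L ℚ) (d : ι → ℕ),
    (∀ i, b i ∈ supported ℚ P) ∧ (∀ i, (b i).IsHomogeneous (d i)) ∧
    (∀ c : ι → ℚ, ∑ i, c i • b i ∈ I → c = 0) ∧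
    (∀ j (p : MvPolynomial L ℚ), p.IsHomogeneous j →
      p ∈ Submodule.span ℚ (b '' {i | d i = j}) ⊔ I.restrictScalars ℚ) ∧
    h = ∑ i, Polynomial.X ^ d i

/-- The Hilbert function is read off from the generating polynomial of a graded basis. -/
theorem HasGradedBasis.finrank_eq {L : Type*} {I : Ideal (MvPolynomial L ℚ)} {P : Set L}
    {h : Polynomial ℕ} (hI : HasGradedBasis I P h) (j : ℕ) :
    Module.finrank ℚ (Matroid.quotientPiece I j) = h.coeff j := by
  classical
  obtain ⟨ι, _, b, d, -, hd, hli, hspan, rfl⟩ := hI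
  set f := (Ideal.Quotient.mkₐ ℚ I).toLinearMap with hf
  have hker (p) : f p = 0 ↔ p ∈ I := Ideal.Quotient.eq_zero_iff_mem
  have hind : LinearIndependent ℚ (fun i => f (b i)) := by
    refine Fintype.linearIndependent_iff.2 fun c hc => ?_
    refine congrFun (hli c ?_)
    rw [← hker, map_sum]
    simpa using hc
  have hpiece : Matroid.quotientPiece I j =
      Submodule.span ℚ (Set.range fun i : {i // d i = j} => f (b i)) := by
    apply le_antisymm
    · rintro _ ⟨p, hp, rfl⟩
      obtain ⟨y, hy, z, hz, rfl⟩ := Submodule.mem_sup.1 (hspan j p hp)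
      rw [← hf, map_add, (hker z).2 hz, add_zero]
      have : f y ∈ (Submodule.span ℚ (b '' {i | d i = j})).map f := ⟨y, hy, rfl⟩
      rw [Submodule.map_span] at this
      refine Submodule.span_mono ?_ this
      rintro _ ⟨_, ⟨i, hi, rfl⟩, rfl⟩
      exact ⟨⟨i, hi⟩, rfl⟩
    · refine Submodule.span_le.2 ?_
      rintro _ ⟨⟨i, rfl⟩, rfl⟩
      exact ⟨b i, hd i, rfl⟩
  have hind' : LinearIndependent ℚ (fun i : {i // d i = j} => f (b i)) :=
    hind.comp Subtype.val Subtype.val_injective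
  rw [hpiece, finrank_span_eq_card hind', Fintype.card_subtype]
  simp [Polynomial.finsetSum_coeff, Polynomial.coeff_X_pow, eq_comm]

section Step

variable {L : Type*} [SemilatticeSup L] [Fintype L] {ρ : L → ℕ} {B : L} {P : Set L}

/-- If all variables vanish then the quotient is `ℚ`. -/
theorem hasGradedBasis_empty : HasGradedBasis (relIdeal ρ B ∅) ∅ 1 := by
  have hX (G : L) : (X G : MvPolynomial L ℚ) ∈ relIdeal ρ B ∅ := (ChowRel.var G (by simp)).mem
  have hle : ∀ p ∈ relIdeal ρ B (∅ : Set L), constantCoeff p = 0 := by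
    intro p hp
    change p ∈ RingHom.ker (constantCoeff (R := ℚ) (σ := L))
    revert p
    refine Ideal.span_le.2 ?_
    rintro p (⟨G, hG⟩ | ⟨G, H, h₁, h₂⟩ | ⟨G, hG⟩ | ⟨G, H, hG, hH, hGH⟩)
    · simp
    · simp
    · exact hG.elim
    · exact hG.elim
  have hmem (p : MvPolynomial L ℚ) : p - C (constantCoeff p) ∈ relIdeal ρ B (∅ : Set L) := by
    induction p using MvPolynomial.induction_on with
    | C a => simp
    | add p q hp hq =>
      convert Ideal.add_mem _ hp hq using 1
      simp only [map_add]
      ring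
    | mul_X p G _ => simpa using Ideal.mul_mem_left _ p (hX G)
  refine ⟨Unit, inferInstance, fun _ => 1, fun _ => 0, fun _ => one_mem _,
    fun _ => isHomogeneous_one _ _, fun c hc => ?_, fun j p hp => ?_, by simp⟩
  · ext
    simpa using hle _ hc
  · rw [← sub_add_cancel p (C (constantCoeff p)), add_comm]
    refine Submodule.add_mem_sup ?_ (hmem p)
    rcases eq_or_ne j 0 with rfl | hj
    · rw [← mul_one (C _), ← smul_eq_C_mul]
      exact Submodule.smul_mem _ _ (Submodule.subset_span ⟨(), rfl, rfl⟩)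
    · rw [constantCoeff_eq, hp.coeff_eq_zero (d := 0) (by simpa using hj.symm)]
      simp

variable {F : L}

open scoped Classical in
/-- The homomorphism that sends `x_F` to a new variable `T` and fixes the other variables. -/
noncomputable def splitVar (F : L) :
    MvPolynomial L ℚ →ₐ[ℚ] Polynomial (MvPolynomial L ℚ) :=
  aeval fun G => if G = F then Polynomial.X else Polynomial.C (X G)

open scoped Classical in
/-- The homomorphism that sets `x_F` to zero. -/
noncomputable def killVar (F : L) : MvPolynomial L ℚ →ₐ[ℚ] MvPolynomial L ℚ :=
  aeval fun G => if G = F then 0 else X G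

omit [SemilatticeSup L] [Fintype L] in
@[simp] theorem splitVar_X_self : splitVar F (X F) = Polynomial.X := by simp [splitVar]

omit [SemilatticeSup L] [Fintype L] in
@[simp] theorem killVar_X_self : killVar F (X F) = 0 := by simp [killVar]

omit [SemilatticeSup L] [Fintype L] in
theorem splitVar_X {G : L} (h : G ≠ F) : splitVar F (X G) = Polynomial.C (X G) := by
  simp [splitVar, h]

omit [SemilatticeSup L] [Fintype L] in
theorem killVar_X {G : L} (h : G ≠ F) : killVar F (X G) = X G := by simp [killVar, h]

omit [SemilatticeSup L] [Fintype L] in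
theorem splitVar_of_mem_supported {Q : Set L} (hF : F ∉ Q) {p : MvPolynomial L ℚ}
    (hp : p ∈ supported ℚ Q) : splitVar F p = Polynomial.C p := by
  induction hp using Algebra.adjoin_induction with
  | mem x hx =>
    obtain ⟨G, hG, rfl⟩ := hx
    exact splitVar_X (by rintro rfl; exact hF hG)
  | algebraMap c => exact (splitVar F).commutes c
  | add x y _ _ hx hy => rw [map_add, hx, hy, map_add]
  | mul x y _ _ hx hy => rw [map_mul, hx, hy, map_mul]

omit [SemilatticeSup L] [Fintype L] in
theorem killVar_of_mem_supported {Q : Set L} (hF : F ∉ Q) {p : MvPolynomial L ℚ}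
    (hp : p ∈ supported ℚ Q) : killVar F p = p := by
  induction hp using Algebra.adjoin_induction with
  | mem x hx =>
    obtain ⟨G, hG, rfl⟩ := hx
    exact killVar_X (by rintro rfl; exact hF hG)
  | algebraMap c => exact (killVar F).commutes c
  | add x y _ _ hx hy => rw [map_add, hx, hy]
  | mul x y _ _ hx hy => rw [map_mul, hx, hy]

theorem hsum_mem_supported (G : L) : hsum G ∈ supported ℚ (Set.Ici G) :=
  Subalgebra.sum_mem _ fun H hH => X_mem_supported.2 (by simpa using hH)

theorem hsum_sub_X_mem_supported (G : L) : hsum G - X G ∈ supported ℚ (Set.Ioi G) := by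
  classical
  have : hsum G - X G = ∑ H with G < H, (X H : MvPolynomial L ℚ) := by
    rw [sub_eq_iff_eq_add, hsum, ← Finset.sum_erase_add _ (a := G) _ (by simp)]
    congr 1
    refine Finset.sum_congr ?_ fun _ _ => rfl
    ext H
    simp [lt_iff_le_and_ne, and_comm, eq_comm]
  rw [this]
  exact Subalgebra.sum_mem _ fun H hH => X_mem_supported.2 (by simpa using hH)

theorem isHomogeneous_hsum (G : L) : (hsum G).IsHomogeneous 1 :=
  IsHomogeneous.sum _ _ _ fun H _ => isHomogeneous_X ℚ H

variable (hρ : IsRank ρ) (hP : IsUpperSet P) (hPB : P ⊆ Set.Ioi B) (hB : B < F)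
  (hFP : F ∉ P) (hF : Set.Ioi F ⊆ P)

section

include hP hB hFP hF

/-- The relations that hold once `F` is added to `P` lie, after `x_F` is renamed to `T`, in the
ideal of `coeff_mem_of_mem_sup`. -/
theorem splitVar_mem {p : MvPolynomial L ℚ} (hp : p ∈ relIdeal ρ B (insert F P)) :
    splitVar F p ∈ (relIdeal ρ B P).map Polynomial.C ⊔
      Ideal.span {Polynomial.X} * (relIdeal ρ F (Set.Ioi F)).map Polynomial.C ⊔
      Ideal.span {(Polynomial.X + Polynomial.C (hsum F - X F)) ^ (ρ F - ρ B)} := by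
  have hI {q : MvPolynomial L ℚ} (hq : q ∈ relIdeal ρ B P) :
      Polynomial.C q ∈ (relIdeal ρ B P).map Polynomial.C ⊔
      Ideal.span {Polynomial.X} * (relIdeal ρ F (Set.Ioi F)).map Polynomial.C ⊔
      Ideal.span {(Polynomial.X + Polynomial.C (hsum F - X F)) ^ (ρ F - ρ B)} :=
    Ideal.mem_sup_left (Ideal.mem_sup_left (Ideal.mem_map_of_mem _ hq))
  have hJ {q : MvPolynomial L ℚ} (hq : q ∈ relIdeal ρ F (Set.Ioi F)) :
      Polynomial.X * Polynomial.C q ∈ (relIdeal ρ B P).map Polynomial.C ⊔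
      Ideal.span {Polynomial.X} * (relIdeal ρ F (Set.Ioi F)).map Polynomial.C ⊔
      Ideal.span {(Polynomial.X + Polynomial.C (hsum F - X F)) ^ (ρ F - ρ B)} :=
    Ideal.mem_sup_left (Ideal.mem_sup_right
      (Ideal.mul_mem_mul (Ideal.mem_span_singleton_self _) (Ideal.mem_map_of_mem _ hq)))
  have hh {G : L} (hG : G ∈ P) : splitVar F (hsum G) = Polynomial.C (hsum G) :=
    splitVar_of_mem_supported (fun h => hFP (hP h hG)) (hsum_mem_supported G)
  rw [← Ideal.mem_comap]
  refine (Ideal.span_le.2 ?_ : relIdeal ρ B _ ≤ _) hp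
  rintro p (⟨G, hG⟩ | ⟨G, H, h₁, h₂⟩ | ⟨G, hG⟩ | ⟨G, H, hG, hH, hGH⟩)
  · simp only [Set.mem_insert_iff, not_or] at hG
    simpa [splitVar_X hG.1] using hI (ChowRel.var G hG.2).mem
  · rw [SetLike.mem_coe, Ideal.mem_comap, map_mul]
    rcases eq_or_ne G F with rfl | hGF
    · rw [splitVar_X_self, splitVar_X (by rintro rfl; exact h₁ le_rfl)]
      exact hJ (ChowRel.var H fun h => h₁ (le_of_lt h)).mem
    · rcases eq_or_ne H F with rfl | hHF
      · rw [splitVar_X_self, splitVar_X hGF, mul_comm]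
        exact hJ (ChowRel.var G fun h => h₂ (le_of_lt h)).mem
      · rw [splitVar_X hGF, splitVar_X hHF, ← map_mul]
        exact hI (ChowRel.incomp G H h₁ h₂).mem
  · rw [SetLike.mem_coe, Ideal.mem_comap, map_pow]
    rcases eq_or_ne G F with rfl | hGF
    · have : splitVar G (hsum G) = Polynomial.X + Polynomial.C (hsum G - X G) := by
        rw [← splitVar_of_mem_supported (fun h => lt_irrefl _ h) (hsum_sub_X_mem_supported G),
          map_sub, splitVar_X_self]
        ring
      rw [this]
      exact Ideal.mem_sup_right (Ideal.mem_span_singleton_self _)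
    · have hG' := hG.resolve_left hGF
      rw [hh hG', ← map_pow]
      exact hI (ChowRel.base G hG').mem
  · have hHF : H ≠ F := by
      rintro rfl
      rcases hG with rfl | hG
      · exact lt_irrefl _ hGH
      · exact hFP (hP hGH.le hG)
    have hH' := hH.resolve_left hHF
    rw [SetLike.mem_coe, Ideal.mem_comap, map_mul, map_pow, hh hH', ← map_pow]
    rcases eq_or_ne G F with rfl | hGF
    · rw [splitVar_X_self]
      exact hJ (ChowRel.base H hGH).mem
    · rw [splitVar_X hGF, ← map_mul]
      exact hI (ChowRel.pair G H (hG.resolve_left hGF) hH' hGH).mem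

/-- A relation that holds before `F` is added to `P`, where `x_F` is zero, still holds afterwards
once the terms containing `x_F` are dropped. -/
theorem killVar_mem {p : MvPolynomial L ℚ} (hp : p ∈ relIdeal ρ B P) :
    killVar F p ∈ relIdeal ρ B (insert F P) := by
  have hh {G : L} (hG : G ∈ P) : killVar F (hsum G) = hsum G :=
    killVar_of_mem_supported (fun h => hFP (hP h hG)) (hsum_mem_supported G)
  rw [← Ideal.mem_comap]
  refine (Ideal.span_le.2 ?_ : relIdeal ρ B _ ≤ _) hp
  rintro p (⟨G, hG⟩ | ⟨G, H, h₁, h₂⟩ | ⟨G, hG⟩ | ⟨G, H, hG, hH, hGH⟩) <;>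
    rw [SetLike.mem_coe, Ideal.mem_comap]
  · rcases eq_or_ne G F with rfl | hGF
    · simp
    · rw [killVar_X hGF]
      exact (ChowRel.var G (by simp [hGF, hG])).mem
  · rw [map_mul]
    rcases eq_or_ne G F with rfl | hGF
    · simp
    rcases eq_or_ne H F with rfl | hHF
    · simp
    rw [killVar_X hGF, killVar_X hHF]
    exact (ChowRel.incomp G H h₁ h₂).mem
  · rw [map_pow, hh hG]
    exact (ChowRel.base G (.inr hG)).mem
  · rw [map_mul, map_pow, hh hH, killVar_X (by rintro rfl; exact hFP hG)]
    exact (ChowRel.pair G H (.inr hG) (.inr hH) hGH).mem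

/-- A relation attached to the base `F` holds after the terms containing `x_F` are dropped and the
rest is multiplied by `x_F`. -/
theorem X_mul_killVar_mem {p : MvPolynomial L ℚ} (hp : p ∈ relIdeal ρ F (Set.Ioi F)) :
    X F * killVar F p ∈ relIdeal ρ B (insert F P) := by
  have hh {G : L} (hG : F < G) : killVar F (hsum G) = hsum G :=
    killVar_of_mem_supported (fun h => hG.not_ge h) (hsum_mem_supported G)
  induction hp using Submodule.span_induction with
  | zero => simp
  | add x y _ _ hx hy => rw [map_add, mul_add]; exact Ideal.add_mem _ hx hy
  | smul c x _ hx =>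
    rw [smul_eq_mul, map_mul, mul_left_comm]; exact Ideal.mul_mem_left _ _ hx
  | mem x hx =>
    rcases hx with ⟨G, hG⟩ | ⟨G, H, h₁, h₂⟩ | ⟨G, hG⟩ | ⟨G, H, hG, hH, hGH⟩
    · rcases eq_or_ne G F with rfl | hGF
      · simp
      rw [killVar_X hGF]
      by_cases hGP : G ∈ P
      · exact (ChowRel.incomp F G (fun h => hG (lt_of_le_of_ne h hGF.symm))
          fun h => hFP (hP h hGP)).mem
      · exact Ideal.mul_mem_left _ _ (ChowRel.var G (by simp [hGF, hGP])).mem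
    · rw [map_mul]
      rcases eq_or_ne G F with rfl | hGF
      · simp
      rcases eq_or_ne H F with rfl | hHF
      · simp
      rw [killVar_X hGF, killVar_X hHF]
      exact Ideal.mul_mem_left _ _ (ChowRel.incomp G H h₁ h₂).mem
    · rw [map_pow, hh hG]
      exact (ChowRel.pair F G (.inl rfl) (.inr (hF hG)) hG).mem
    · rw [map_mul, map_pow, hh hH, killVar_X (ne_of_gt hG)]
      exact Ideal.mul_mem_left _ _ (ChowRel.pair G H (.inr (hF hG)) (.inr (hF hH)) hGH).mem

end

include hρ hP hPB hB hFP hF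

/-- Adding to `P` a new minimal element `F` adds to the basis the products of the powers `x_F^i`,
`1 ≤ i < ρ F - ρ B`, with a basis attached to the elements above `F`. -/
theorem HasGradedBasis.insert {h h' : Polynomial ℕ} (hI : HasGradedBasis (relIdeal ρ B P) P h)
    (hJ : HasGradedBasis (relIdeal ρ F (Set.Ioi F)) (Set.Ioi F) h') :
    HasGradedBasis (relIdeal ρ B (insert F P)) (insert F P)
      (h + (∑ i : Fin (ρ F - ρ B - 1), Polynomial.X ^ (i.val + 1)) * h') := by
  classical
  have hr : 0 < ρ F - ρ B := by have := hρ.strictMono hB; omega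
  obtain ⟨ι, _, b, d, hb, hd, hli, hspan, rfl⟩ := hI
  obtain ⟨κ, _, b', d', hb', hd', hli', hspan', rfl⟩ := hJ
  set r := ρ F - ρ B
  set I := relIdeal ρ B P
  set J := relIdeal ρ F (Set.Ioi F)
  set I' := relIdeal ρ B (Insert.insert F P)
  set s := hsum F - X F with hs
  let β : ι ⊕ (Fin (r - 1) × κ) → MvPolynomial L ℚ :=
    Sum.elim b fun x => X F ^ (x.1.val + 1) * b' x.2
  let δ : ι ⊕ (Fin (r - 1) × κ) → ℕ := Sum.elim d fun x => x.1.val + 1 + d' x.2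
  refine ⟨ι ⊕ (Fin (r - 1) × κ), inferInstance, β, δ, ?_, ?_, ?_, ?_, ?_⟩
  · rintro (i | ⟨i, k⟩)
    · exact supported_mono (Set.subset_insert _ _) (hb i)
    · exact mul_mem (pow_mem (X_mem_supported.2 (Set.mem_insert _ _)) _)
        (supported_mono (hF.trans (Set.subset_insert _ _)) (hb' k))
  · rintro (i | ⟨i, k⟩)
    · exact hd i
    · exact (isHomogeneous_X_pow F _).mul (hd' k)
  · intro c hc
    set A := ∑ i, c (.inl i) • b i with hA
    let D : Fin (r - 1) → MvPolynomial L ℚ := fun i => ∑ k, c (.inr (i, k)) • b' k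
    have hq : splitVar F (∑ i, c i • β i) =
        Polynomial.C A + ∑ i, Polynomial.X ^ (i.val + 1) * Polynomial.C (D i) := by
      have h1 (i) : splitVar F (c (.inl i) • β (.inl i)) = Polynomial.C (c (.inl i) • b i) :=
        splitVar_of_mem_supported hFP (Subalgebra.smul_mem _ (hb i) _)
      have h2 (i k) : splitVar F (c (.inr (i, k)) • β (.inr (i, k))) =
          Polynomial.X ^ (i.val + 1) * Polynomial.C (c (.inr (i, k)) • b' k) := by
        change splitVar F (c (.inr (i, k)) • (X F ^ (i.val + 1) * b' k)) = _
        rw [← mul_smul_comm, map_mul, map_pow, splitVar_X_self,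
          splitVar_of_mem_supported (Q := Set.Ioi F) (lt_irrefl _)
            (Subalgebra.smul_mem _ (hb' k) _)]
      rw [map_sum, Fintype.sum_sum_type, Fintype.sum_prod_type]
      simp only [h1, h2, hA, D, map_sum, Finset.mul_sum]
    -- The coefficients of `T ^ 0` and `T ^ (i + 1)` are combinations of `b` and of `b'`.
    have hmem := splitVar_mem hP hB hFP hF hc
    have hdeg : (splitVar F (∑ i, c i • β i)).natDegree < r := by
      rw [hq]
      refine lt_of_le_of_lt (Polynomial.natDegree_add_le_of_degree_le (n := r - 1) (by simp) ?_)
        (by omega)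
      refine Polynomial.natDegree_sum_le_of_forall_le _ _ fun i _ => ?_
      exact (Polynomial.natDegree_mul_C_le _ _).trans
        ((Polynomial.natDegree_X_pow_le _).trans i.2)
    obtain ⟨h0, hpos⟩ := coeff_mem_of_mem_sup (relIdeal_le_relIdeal_Ioi hρ hP hPB hB hFP hF)
      (fun a ha => mul_pow_mem_of_mem_relIdeal_Ioi hρ hP hPB hB hFP hF ha) hdeg hmem
    rw [hq] at h0 hpos
    have hA0 : (fun i => c (.inl i)) = 0 := by
      apply hli
      simpa [Polynomial.coeff_X_pow] using h0
    have hD0 (i : Fin (r - 1)) : (fun k => c (.inr (i, k))) = 0 := by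
      apply hli'
      have := hpos (i.val + 1)
      simpa [Polynomial.coeff_X_pow, Polynomial.coeff_C_succ, Fin.val_inj] using this
    ext (i | ⟨i, k⟩)
    · exact congrFun hA0 i
    · exact congrFun (hD0 i) k
  · let W : ℕ → Submodule ℚ (MvPolynomial L ℚ) := fun j =>
      Submodule.span ℚ (β '' {i | δ i = j}) ⊔ I'.restrictScalars ℚ
    have hks : killVar F s = s :=
      killVar_of_mem_supported (Q := Set.Ioi F) (lt_irrefl _) (hsum_sub_X_mem_supported F)
    have hsum_mem : hsum F ^ r ∈ I' := (ChowRel.base F (.inl rfl)).mem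
    -- Powers of `x_F` beyond the `r`-th are reduced by the relation `(x_F + s) ^ r = 0`.
    have key : ∀ a j (m : MvPolynomial L ℚ), m.IsHomogeneous j → killVar F m = m →
        X F ^ a * m ∈ W (a + j) := by
      intro a
      induction a using Nat.strong_induction_on with
      | _ a ih =>
      intro j m hm hk
      rcases lt_or_ge a r with har | har
      · rcases Nat.eq_zero_or_pos a with rfl | ha
        · obtain ⟨y, hy, z, hz, hyz⟩ := Submodule.mem_sup.1 (hspan j m hm)
          rw [pow_zero, one_mul, zero_add, ← hk, ← hyz, map_add]
          refine Submodule.add_mem_sup ?_ (killVar_mem hP hB hFP hF hz)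
          rw [killVar_of_mem_supported hFP]
          · refine Submodule.span_mono ?_ hy
            rintro _ ⟨i, hi, rfl⟩
            exact ⟨.inl i, hi, rfl⟩
          · refine (Submodule.span_le (p := Subalgebra.toSubmodule (supported ℚ P))).2 ?_ hy
            rintro _ ⟨i, -, rfl⟩
            exact hb i
        · obtain ⟨y, hy, z, hz, hyz⟩ := Submodule.mem_sup.1 (hspan' j m hm)
          rw [← hk, ← hyz, map_add, mul_add]
          obtain ⟨a, rfl⟩ := Nat.exists_eq_add_of_lt ha
          refine Submodule.add_mem_sup ?_ ?_
          · rw [killVar_of_mem_supported (Q := Set.Ioi F) (lt_irrefl _)]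
            · have hy' : X F ^ (0 + a + 1) * y ∈ (Submodule.span ℚ (b' '' {i | d' i = j})).map
                  (LinearMap.mulLeft ℚ (X F ^ (0 + a + 1))) := ⟨y, hy, rfl⟩
              rw [Submodule.map_span] at hy'
              refine Submodule.span_mono ?_ hy'
              rintro _ ⟨_, ⟨k, hk, rfl⟩, rfl⟩
              refine ⟨.inr (⟨a, by omega⟩, k), ?_, ?_⟩
              · have : d' k = j := hk
                simp only [Set.mem_ofPred_eq, δ, Sum.elim_inr]
                omega
              · simp [β]
            · refine (Submodule.span_le
                (p := Subalgebra.toSubmodule (supported ℚ (Set.Ioi F)))).2 ?_ hy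
              rintro _ ⟨i, -, rfl⟩
              exact hb' i
          · rw [pow_succ, mul_assoc]
            exact Ideal.mul_mem_left _ _ (X_mul_killVar_mem hP hB hFP hF hz)
      · have hexp : X F ^ a * m = X F ^ (a - r) * m * hsum F ^ r -
            ∑ i ∈ Finset.range r,
              X F ^ (a - r + i) * (s ^ (r - i) * (r.choose i : MvPolynomial L ℚ) * m) := by
          have h1 : hsum F ^ r = ∑ i ∈ Finset.range r,
              X F ^ i * s ^ (r - i) * (r.choose i : MvPolynomial L ℚ) + X F ^ r := by
            rw [show hsum F = X F + s by rw [hs]; ring, add_pow, Finset.sum_range_succ]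
            simp
          rw [h1, eq_sub_iff_add_eq, mul_add, Finset.mul_sum, add_comm]
          congr 1
          · refine Finset.sum_congr rfl fun i _ => ?_
            rw [pow_add]; ring
          · rw [mul_right_comm, ← pow_add, Nat.sub_add_cancel har]
        rw [hexp]
        refine Submodule.sub_mem _ ?_ (Submodule.sum_mem _ fun i hi => ?_)
        · exact Submodule.mem_sup_right (Ideal.mul_mem_left _ _ hsum_mem)
        · have hi' := Finset.mem_range.1 hi
          have hhom : (s ^ (r - i) * (r.choose i : MvPolynomial L ℚ) * m).IsHomogeneous
              (r - i + j) := by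
            have h1 : s.IsHomogeneous 1 := (isHomogeneous_hsum F).sub (isHomogeneous_X ℚ F)
            have h2 : ((r.choose i : ℕ) : MvPolynomial L ℚ).IsHomogeneous 0 := by
              rw [← map_natCast (C : ℚ →+* MvPolynomial L ℚ)]
              exact isHomogeneous_C _ _
            simpa using ((h1.pow (r - i)).mul h2).mul hm
          have := ih (a - r + i) (by omega) (r - i + j) _ hhom (by simp [hks, hk])
          rwa [show a - r + i + (r - i + j) = a + j by omega] at this
    intro j p hp
    rw [p.as_sum]
    refine Submodule.sum_mem _ fun v hv => ?_
    have hvj : v.degree = j := by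
      have := hp (mem_support_iff.1 hv)
      rw [Finsupp.degree_eq_weight_one]
      exact this
    have hsplit : monomial v (coeff v p) =
        X F ^ v F * monomial (v.erase F) (coeff v p) := by
      rw [X_pow_eq_monomial, monomial_mul, one_mul, Finsupp.single_add_erase]
    have hdeg : v F + (v.erase F).degree = j := by
      rw [← hvj]
      conv_rhs => rw [← Finsupp.single_add_erase F v]
      simp
    rw [hsplit]
    have := key (v F) (v.erase F).degree (monomial (v.erase F) (coeff v p))
      (isHomogeneous_monomial _ rfl) ?_
    · rwa [hdeg] at this
    · refine killVar_of_mem_supported (Q := {F}ᶜ) (by simp) (mem_supported.2 fun G hG => ?_)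
      have : G ∈ (v.erase F).support := by
        by_cases hc : coeff v p = 0
        · simp [hc] at hG
        · rwa [vars_monomial hc] at hG
      rw [Finsupp.support_erase] at this
      simpa using (Finset.mem_erase.1 this).1
  · rw [Fintype.sum_sum_type, Fintype.sum_prod_type, Finset.sum_mul_sum]
    simp [δ, pow_add]

end Step

end ChowBasis

/-! ### The Hilbert series by recursion over the elements above the base -/

namespace ChowBasis

open MvPolynomial

section Recursion

variable {L : Type*} [SemilatticeSup L] [Fintype L]

/-- The polynomial `x + x^2 + ⋯ + x^(r - 1)`. -/
noncomputable def truncGeom (r : ℕ) : Polynomial ℕ :=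
  ∑ i : Fin (r - 1), Polynomial.X ^ (i.val + 1)

open scoped Classical in
/-- The Hilbert series attached to a base element `B`, defined by recursion over the elements above
`B`. Unfolding the recursion gives a sum over all chains above `B`. -/
noncomputable def fyPoly (ρ : L → ℕ) (B : L) : Polynomial ℕ :=
  1 + ∑ F ∈ (Finset.univ.filter (B < ·)).attach,
    have : B < F.1 := (Finset.mem_filter.1 F.2).2
    truncGeom (ρ F - ρ B) * fyPoly ρ F.1
termination_by wellFounded_gt.wrap B

open scoped Classical in
theorem fyPoly_eq (ρ : L → ℕ) (B : L) :
    fyPoly ρ B = 1 + ∑ F with B < F, truncGeom (ρ F - ρ B) * fyPoly ρ F := by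
  rw [fyPoly, Finset.sum_attach (Finset.univ.filter (B < ·))
    fun F => truncGeom (ρ F - ρ B) * fyPoly ρ F]

/-- The elements above `B` are added one by one, each after all elements above it. -/
theorem hasGradedBasis_Ioi {ρ : L → ℕ} (hρ : IsRank ρ) (B : L) :
    HasGradedBasis (relIdeal ρ B (Set.Ioi B)) (Set.Ioi B) (fyPoly ρ B) := by
  classical
  induction B using WellFoundedGT.induction with
  | _ B ih =>
  have main : ∀ n, ∀ Q : Finset L, Q.card = n → IsUpperSet (Q : Set L) →
      (Q : Set L) ⊆ Set.Ioi B → HasGradedBasis (relIdeal ρ B (Q : Set L)) (Q : Set L)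
        (1 + ∑ F ∈ Q, truncGeom (ρ F - ρ B) * fyPoly ρ F) := by
    intro n
    induction n with
    | zero =>
      intro Q hQ _ _
      rw [Finset.card_eq_zero] at hQ
      subst hQ
      simpa using hasGradedBasis_empty (ρ := ρ) (B := B)
    | succ n ihn =>
      intro Q hQ hup hB
      obtain ⟨F, hF⟩ := Q.exists_minimal (Finset.card_pos.1 (by omega))
      have hmin {G : L} (hG : G ∈ Q) (h : G ≤ F) : G = F := h.antisymm (hF.2 hG h)
      have hIoi : Set.Ioi F ⊆ (Q.erase F : Finset L) := fun G hG => by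
        simpa using ⟨hup (le_of_lt hG) hF.1, ne_of_gt hG⟩
      have hup' : IsUpperSet ((Q.erase F : Finset L) : Set L) := by
        intro G H hGH hG
        simp only [Finset.coe_erase, Set.mem_sdiff, Finset.mem_coe, Set.mem_singleton_iff] at hG ⊢
        exact ⟨hup hGH hG.1, fun h => hG.2 (hmin hG.1 (h ▸ hGH))⟩
      have hsub : ((Q.erase F : Finset L) : Set L) ⊆ Set.Ioi B :=
        (Finset.coe_subset.2 (Q.erase_subset F)).trans hB
      have h1 := ihn (Q.erase F) (by rw [Finset.card_erase_of_mem hF.1]; omega) hup' hsub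
      have h2 := h1.insert hρ hup' hsub (hB hF.1) (by simp) hIoi (ih F (hB hF.1))
      rw [← Finset.coe_insert, Finset.insert_erase hF.1] at h2
      rw [← Finset.sum_erase_add _ _ hF.1, ← add_assoc]
      exact h2
  have := main _ (Finset.univ.filter (B < ·)) rfl
    (fun G H hGH hG => by simpa using lt_of_lt_of_le (by simpa using hG) hGH)
    (fun G hG => by simpa using hG)
  rw [fyPoly_eq]
  have hset : ((Finset.univ.filter (B < ·) : Finset L) : Set L) = Set.Ioi B := by ext; simp
  rwa [hset] at this

/-- If rank-preserving injections exist between the elements above `F` and those above `F'`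
whenever `F` and `F'` have the same rank, then the Hilbert series are comparable. -/
theorem coeff_fyPoly_le {L' : Type*} [SemilatticeSup L'] [Fintype L'] {ρ : L → ℕ} {ρ' : L' → ℕ}
    (h : ∀ F F', ρ F = ρ' F' → ∃ φ : L → L', Set.InjOn φ (Set.Ioi F) ∧
      ∀ G, F < G → F' < φ G ∧ ρ' (φ G) = ρ G)
    (F : L) (F' : L') (hF : ρ F = ρ' F') (j : ℕ) :
    (fyPoly ρ F).coeff j ≤ (fyPoly ρ' F').coeff j := by
  classical
  induction F using WellFoundedGT.induction generalizing F' j with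
  | _ F ih =>
  obtain ⟨φ, hinj, hφ⟩ := h F F' hF
  rw [fyPoly_eq, fyPoly_eq, Polynomial.coeff_add, Polynomial.coeff_add,
    Polynomial.finsetSum_coeff, Polynomial.finsetSum_coeff]
  refine Nat.add_le_add_left ?_ _
  calc ∑ G with F < G, (truncGeom (ρ G - ρ F) * fyPoly ρ G).coeff j
      ≤ ∑ G with F < G, (truncGeom (ρ' (φ G) - ρ' F') * fyPoly ρ' (φ G)).coeff j := by
        refine Finset.sum_le_sum fun G hG => ?_
        have hG' : F < G := by simpa using hG
        rw [(hφ G hG').2, hF, Polynomial.coeff_mul, Polynomial.coeff_mul]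
        exact Finset.sum_le_sum fun x _ =>
          Nat.mul_le_mul_left _ (ih G hG' (φ G) (hφ G hG').2.symm x.2)
    _ = ∑ G ∈ (Finset.univ.filter (F < ·)).image φ,
          (truncGeom (ρ' G - ρ' F') * fyPoly ρ' G).coeff j := by
        rw [Finset.sum_image]
        simpa [Set.InjOn] using hinj
    _ ≤ _ := by
        refine Finset.sum_le_sum_of_subset fun G hG => ?_
        obtain ⟨H, hH, rfl⟩ := Finset.mem_image.1 hG
        simpa using (hφ H (by simpa using hH)).1

end Recursion

/-! ### Relations coming from covers -/

section Covers

variable {L : Type*} [SemilatticeSup L] [Fintype L] {ρ : L → ℕ} {B : L}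

/-- With `F' ≤ G` covering `F` and `d = ρ G - ρ F`, the power `h_G ^ d` is `h_G ^ (d - 1) * h_{F'}`
minus the terms `h_G ^ (d - 1) * x_K` with `K ≥ F'` and `K ≱ G`. -/
theorem mul_hsum_pow_mem (hρ : IsRank ρ) {I : Ideal (MvPolynomial L ℚ)} {c : MvPolynomial L ℚ}
    {F G : L} (hFG : F < G) (hc : ∀ F', F < F' → ρ F' = ρ F + 1 → c * hsum F' ∈ I)
    (hK : ∀ K, F < K → ¬ G ≤ K → ρ (G ⊔ K) + 1 ≤ ρ K + (ρ G - ρ F) →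
      X K * hsum G ^ (ρ G - ρ F - 1) ∈ I) :
    c * hsum G ^ (ρ G - ρ F) ∈ I := by
  classical
  obtain ⟨F', hFF', hF'G, hF'⟩ := hρ.exists_succ F G hFG
  have hlt := hρ.strictMono hFG
  set d := ρ G - ρ F with hd
  have hexp : c * hsum G ^ d = hsum G ^ (d - 1) * (c * hsum F') -
      c * ∑ K with F' ≤ K ∧ ¬ G ≤ K, X K * hsum G ^ (d - 1) := by
    rw [← Finset.sum_mul, ← hsum_sub_hsum hF'G, ← Nat.sub_add_cancel (show 1 ≤ d by omega)]
    simp only [Nat.add_sub_cancel]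
    ring
  rw [hexp]
  refine I.sub_mem (I.mul_mem_left _ (hc F' hFF' hF')) (I.mul_mem_left _ (I.sum_mem fun K h => ?_))
  simp only [Finset.mem_filter, Finset.mem_univ, true_and] at h
  refine hK K (hFF'.trans_le h.1) h.2 ?_
  have := hρ.submodular F' G K hF'G h.1
  omega

/-- The ideal attached to `B` is generated by the variables not above `B`, the products of
incomparable variables and the relations of covers. -/
theorem relIdeal_Ioi_le (hρ : IsRank ρ) {I : Ideal (MvPolynomial L ℚ)}
    (hvar : ∀ G, ¬ B < G → X G ∈ I) (hinc : ∀ F G : L, ¬ F ≤ G → ¬ G ≤ F → X F * X G ∈ I)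
    (hbase : ∀ G, B < G → ρ G = ρ B + 1 → hsum G ∈ I)
    (hpair : ∀ F G, B < F → F < G → ρ G = ρ F + 1 → X F * hsum G ∈ I) :
    relIdeal ρ B (Set.Ioi B) ≤ I := by
  have hsup {d : ℕ} {G K : L} (hKG : ¬ G ≤ K) (hd : ρ (G ⊔ K) + 1 ≤ ρ K + d)
      (h : X K * hsum (G ⊔ K) ^ (ρ (G ⊔ K) - ρ K) ∈ I) : X K * hsum G ^ (d - 1) ∈ I :=
    mul_pow_mem_of_mul_sub_mem _ (X_mul_hsum_sub_mem I hinc hKG)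
      (pow_mem_of_le (by omega) h)
  have key : ∀ d F G, B < F → F < G → ρ G = ρ F + d → X F * hsum G ^ (ρ G - ρ F) ∈ I := by
    intro d
    induction d using Nat.strong_induction_on with
    | _ d ih =>
    intro F G hBF hFG hd
    refine mul_hsum_pow_mem hρ hFG (fun F' h1 h2 => hpair F F' hBF h1 h2) fun K hFK hGK hK => ?_
    have hlt : K < G ⊔ K := lt_of_le_of_ne le_sup_right fun h => hGK (h ▸ le_sup_left)
    have := hρ.strictMono hlt
    exact hsup hGK hK (ih (ρ (G ⊔ K) - ρ K) (by omega) K _ (hBF.trans hFK) hlt (by omega))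
  refine Ideal.span_le.2 ?_
  rintro p (⟨G, hG⟩ | ⟨G, H, h₁, h₂⟩ | ⟨G, hG⟩ | ⟨G, H, hG, hH, hGH⟩)
  · exact hvar G hG
  · exact hinc G H h₁ h₂
  · have := mul_hsum_pow_mem hρ (I := I) (c := 1) (F := B) (G := G) hG
      (fun F' h1 h2 => by simpa using hbase F' h1 h2) fun K hBK hGK hK => ?_
    · simpa using this
    · have hlt : K < G ⊔ K := lt_of_le_of_ne le_sup_right fun h => hGK (h ▸ le_sup_left)
      have := hρ.strictMono hlt
      exact hsup hGK hK (key (ρ (G ⊔ K) - ρ K) K _ hBK hlt (by omega))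
  · exact key (ρ H - ρ G) G H hG hGH (by have := hρ.strictMono hGH; omega)

end Covers

/-! ### Comparing graded quotients -/

section Transfer

variable {σ τ : Type*}

/-- A linear substitution `u` that carries `I` into `I'`, and has a right inverse modulo `I'`, maps
each graded piece onto the corresponding piece. -/
theorem finrank_quotientPiece_le [Finite σ] {I : Ideal (MvPolynomial σ ℚ)}
    {I' : Ideal (MvPolynomial τ ℚ)} {u : σ → MvPolynomial τ ℚ} {v : τ → MvPolynomial σ ℚ}
    (hu : ∀ s, (u s).IsHomogeneous 1) (hv : ∀ t, (v t).IsHomogeneous 1)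
    (hI : I ≤ I'.comap (aeval u)) (huv : ∀ t, aeval u (v t) - X t ∈ I') (j : ℕ) :
    Module.finrank ℚ (Matroid.quotientPiece I' j) ≤
      Module.finrank ℚ (Matroid.quotientPiece I j) := by
  let f : (MvPolynomial σ ℚ ⧸ I) →ₐ[ℚ] (MvPolynomial τ ℚ ⧸ I') :=
    Ideal.quotientMapₐ I' (aeval u) hI
  have huv' (p : MvPolynomial τ ℚ) : Ideal.Quotient.mkₐ ℚ I' (aeval u (aeval v p)) =
      Ideal.Quotient.mkₐ ℚ I' p := by
    have : ((Ideal.Quotient.mkₐ ℚ I').comp ((aeval u).comp (aeval v))) =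
        Ideal.Quotient.mkₐ ℚ I' := by
      ext t
      simpa [Ideal.Quotient.eq] using huv t
    exact DFunLike.congr_fun this p
  have hmap : Matroid.quotientPiece I' j = (Matroid.quotientPiece I j).map f.toLinearMap := by
    apply le_antisymm
    · rintro _ ⟨p, hp, rfl⟩
      refine ⟨Ideal.Quotient.mkₐ ℚ I (aeval v p), ⟨aeval v p, ?_, rfl⟩, huv' p⟩
      simpa using IsHomogeneous.aeval hp v hv
    · rintro _ ⟨_, ⟨p, hp, rfl⟩, rfl⟩
      exact ⟨aeval u p, by simpa using IsHomogeneous.aeval hp u hu, rfl⟩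
  have : Module.Finite ℚ (Matroid.quotientPiece I j) :=
    Module.Finite.iff_fg.2 ((homogeneousSubmodule_fg σ ℚ j).map _)
  rw [hmap]
  exact Submodule.finrank_map_le _ _

/-- Two quotients of polynomial rings have the same Hilbert function if linear substitutions carry
one ideal into the other and are inverse to each other on the quotients. -/
theorem finrank_quotientPiece_eq [Finite σ] [Finite τ] {I : Ideal (MvPolynomial σ ℚ)}
    {I' : Ideal (MvPolynomial τ ℚ)} {u : σ → MvPolynomial τ ℚ} {v : τ → MvPolynomial σ ℚ}
    (hu : ∀ s, (u s).IsHomogeneous 1) (hv : ∀ t, (v t).IsHomogeneous 1)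
    (hI : I ≤ I'.comap (aeval u)) (hI' : I' ≤ I.comap (aeval v))
    (huv : ∀ t, aeval u (v t) - X t ∈ I') (hvu : ∀ s, aeval v (u s) - X s ∈ I) (j : ℕ) :
    Module.finrank ℚ (Matroid.quotientPiece I j) =
      Module.finrank ℚ (Matroid.quotientPiece I' j) :=
  le_antisymm (finrank_quotientPiece_le hv hu hI' hvu j) (finrank_quotientPiece_le hu hv hI huv j)

end Transfer

end ChowBasis

/-! ### The lattice of flats with an added bottom element -/

namespace ChowBasis

open MvPolynomial

section Flats

variable {α : Type*}

/-- The flats of `M`, ordered by inclusion. -/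
abbrev Flats (M : Matroid α) : Type _ := {F : Set α // M.IsFlat F}

instance (M : Matroid α) : SemilatticeSup (Flats M) where
  sup F G := ⟨M.closure (F.1 ∪ G.1), M.isFlat_closure _⟩
  le_sup_left F G := Set.subset_union_left.trans
    (M.subset_closure _ (Set.union_subset F.2.subset_ground G.2.subset_ground))
  le_sup_right F G := Set.subset_union_right.trans
    (M.subset_closure _ (Set.union_subset F.2.subset_ground G.2.subset_ground))
  sup_le _ _ H h₁ h₂ := (M.closure_subset_closure (Set.union_subset h₁ h₂)).trans H.2.closure.le

noncomputable instance (M : Matroid α) [M.Finite] : Fintype (Flats M) :=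
  ((M.ground_finite.finite_subsets).subset fun _ hF => hF.subset_ground).fintype

variable {M : Matroid α}

/-- The rank of a set as a natural number; sets of infinite rank get the value `0`. -/
noncomputable def natRank (M : Matroid α) (X : Set α) : ℕ := (M.eRk X).toNat

/-- The rank function on the flats with an added bottom element: a flat `F` has rank
`M.eRk F + 1`, leaving `0` for the added element. -/
noncomputable def botRank (M : Matroid α) : WithBot (Flats M) → ℕ :=
  WithBot.recBotCoe 0 fun F => natRank M F.1 + 1

@[simp] theorem botRank_bot : botRank M ⊥ = 0 := rfl

@[simp] theorem botRank_coe (F : Flats M) : botRank M F = natRank M F.1 + 1 := rfl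

theorem sup_val (F G : Flats M) : (F ⊔ G).1 = M.closure (F.1 ∪ G.1) := rfl

theorem natRank_closure (X : Set α) : natRank M (M.closure X) = natRank M X := by
  rw [natRank, M.eRk_closure_eq, natRank]

theorem natRank_empty : natRank M ∅ = 0 := by simp [natRank]

section Finite

variable [M.Finite]

theorem coe_natRank (X : Set α) : (natRank M X : ℕ∞) = M.eRk X :=
  ENat.natCast_toNat (Matroid.eRk_ne_top_iff.2 (M.isRkFinite_set X))

theorem natRank_mono {X Y : Set α} (h : X ⊆ Y) : natRank M X ≤ natRank M Y := by
  have := M.eRk_mono h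
  rw [← coe_natRank, ← coe_natRank] at this
  exact_mod_cast this

theorem natRank_inter_add_natRank_union_le (X Y : Set α) :
    natRank M (X ∩ Y) + natRank M (X ∪ Y) ≤ natRank M X + natRank M Y := by
  have := M.eRk_inter_add_eRk_union_le X Y
  simp only [← coe_natRank] at this
  exact_mod_cast this

theorem natRank_insert {X : Set α} {e : α} (he : e ∈ M.E \ M.closure X) :
    natRank M (insert e X) = natRank M X + 1 := by
  have := M.eRk_insert_eq_add_one he
  simp only [← coe_natRank] at this
  exact_mod_cast this

theorem eq_of_natRank_le {F G : Set α} (hF : M.IsFlat F) (hG : M.IsFlat G) (h : F ⊆ G)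
    (hr : natRank M G ≤ natRank M F) : F = G := by
  rw [← hF.closure, ← hG.closure]
  refine (M.isRkFinite_set F).closure_eq_closure_of_subset_of_eRk_ge_eRk h ?_
  rw [← coe_natRank, ← coe_natRank]
  exact_mod_cast hr

theorem isRank_botRank : IsRank (botRank M) where
  strictMono := by
    intro F G hFG
    induction G with
    | bot => exact (not_lt_bot hFG).elim
    | coe G =>
    induction F with
    | bot => simp
    | coe F =>
    have hFG' : F < G := WithBot.coe_lt_coe.1 hFG
    simp only [botRank_coe, add_lt_add_iff_right]
    by_contra hle
    exact hFG'.ne (Subtype.ext (eq_of_natRank_le F.2 G.2 hFG'.le (not_lt.1 hle)))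
  submodular := by
    intro B G H hG hH
    induction G with
    | bot => simp_all
    | coe G =>
    induction H with
    | bot => simp_all
    | coe H =>
    have hGH := natRank_inter_add_natRank_union_le (M := M) G.1 H.1
    rw [← WithBot.coe_sup, botRank_coe, botRank_coe, botRank_coe, sup_val, natRank_closure]
    induction B with
    | bot => rw [botRank_bot]; omega
    | coe B =>
    rw [botRank_coe]
    have hBG : B ≤ G := WithBot.coe_le_coe.1 hG
    have hBH : B ≤ H := WithBot.coe_le_coe.1 hH
    have := natRank_mono (M := M) (Set.subset_inter hBG hBH)
    omega
  exists_succ := by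
    intro F G hFG
    induction G with
    | bot => exact (not_lt_bot hFG).elim
    | coe G =>
    induction F with
    | bot =>
      refine ⟨((⟨M.closure ∅, M.isFlat_closure _⟩ : Flats M) : WithBot (Flats M)),
        WithBot.bot_lt_coe _, WithBot.coe_le_coe.2 ?_, ?_⟩
      · exact (M.closure_subset_closure (Set.empty_subset G.1)).trans G.2.closure.le
      · simp [natRank_closure, natRank_empty]
    | coe F =>
    have hFG' : F < G := WithBot.coe_lt_coe.1 hFG
    obtain ⟨hle, e, heG, heF⟩ := Set.ssubset_iff_exists.1 (show F.1 ⊂ G.1 from hFG')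
    have heE : e ∈ M.E := G.2.subset_ground heG
    have hins : insert e F.1 ⊆ M.closure (insert e F.1) :=
      M.subset_closure _ (Set.insert_subset heE F.2.subset_ground)
    refine ⟨((⟨M.closure (insert e F.1), M.isFlat_closure _⟩ : Flats M) : WithBot (Flats M)),
      WithBot.coe_lt_coe.2 ?_, WithBot.coe_le_coe.2 ?_, ?_⟩
    · exact ⟨(Set.subset_insert _ _).trans hins, fun h => heF (h (hins (Set.mem_insert _ _)))⟩
    · exact (M.closure_subset_closure (Set.insert_subset heG hle)).trans G.2.closure.le
    · rw [botRank_coe, botRank_coe, natRank_closure, natRank_insert ⟨heE, by rwa [F.2.closure]⟩]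

/-- If `G` is a flat of rank one more than a flat `F ⊆ G` and `e ∈ G \ F`, then `G` is the smallest
flat containing `F` and `e`. -/
theorem subset_iff_of_natRank_eq_succ {F G H : Set α} (hF : M.IsFlat F) (hG : M.IsFlat G)
    (hH : M.IsFlat H) (hFG : F ⊆ G) (hr : natRank M G = natRank M F + 1) {e : α} (he : e ∈ G)
    (heF : e ∉ F) : G ⊆ H ↔ F ⊆ H ∧ e ∈ H := by
  refine ⟨fun h => ⟨hFG.trans h, h he⟩, fun ⟨h1, h2⟩ => ?_⟩
  have hcl : M.closure (insert e F) = G := by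
    refine eq_of_natRank_le (M.isFlat_closure _) hG
      ((M.closure_subset_closure (Set.insert_subset he hFG)).trans hG.closure.le) ?_
    rw [natRank_closure, natRank_insert ⟨hG.subset_ground he, by rwa [hF.closure]⟩, hr]
  rw [← hcl]
  exact (M.closure_subset_closure (Set.insert_subset h2 h1)).trans hH.closure.le

end Finite

end Flats

/-- A sum over the elements that satisfy `p`, all of which are `a` or of the form `f s`, split into
the term of `a` and a sum over the `s`. -/
theorem sum_filter_eq_add_sum_comp {σ τ A : Type*} [Fintype σ] [Fintype τ] [AddCommMonoid A]
    {f : σ → τ} (hf : Function.Injective f) {a : τ} (ha : ∀ s, f s ≠ a) {p : τ → Prop}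
    {q : σ → Prop} {_ : DecidablePred p} [DecidablePred q] (hp : p a) (hq : ∀ s, q s ↔ p (f s))
    (hcov : ∀ t, p t → t = a ∨ ∃ s, f s = t) (g : τ → A) :
    ∑ t with p t, g t = g a + ∑ s with q s, g (f s) := by
  classical
  have : Finset.univ.filter p = insert a ((Finset.univ.filter q).image f) := by
    ext t
    simp only [Finset.mem_filter, Finset.mem_univ, true_and, Finset.mem_insert, Finset.mem_image,
      hq]
    constructor
    · intro h
      rcases hcov t h with rfl | ⟨s, rfl⟩
      · exact .inl rfl
      · exact .inr ⟨s, h, rfl⟩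
    · rintro (rfl | ⟨s, h, rfl⟩)
      · exact hp
      · exact h
  rw [this, Finset.sum_insert (by simp [ha]), Finset.sum_image fun _ _ _ _ h => hf h]

section Chow

variable {α : Type*} (M : Matroid α)

/-- The ground set as an element of the lattice of flats with an added bottom. -/
def topFlat : WithBot (Flats M) := ((⟨M.E, M.ground_isFlat⟩ : Flats M) : WithBot (Flats M))

/-- The set of loops, which is the smallest flat, as an element of the lattice of flats with an
added bottom. -/
def loopFlat : WithBot (Flats M) :=
  ((⟨M.closure ∅, M.isFlat_closure ∅⟩ : Flats M) : WithBot (Flats M))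

/-- The smallest flat containing `i`, as an element of the lattice of flats with an added bottom. -/
def pointFlat (i : α) : WithBot (Flats M) :=
  ((⟨M.closure {i}, M.isFlat_closure {i}⟩ : Flats M) : WithBot (Flats M))

variable {M}

theorem le_topFlat (F : WithBot (Flats M)) : F ≤ topFlat M := by
  induction F with
  | bot => exact bot_le
  | coe F => exact WithBot.coe_le_coe.2 F.2.subset_ground

theorem loopFlat_le (F : Flats M) : loopFlat M ≤ F :=
  WithBot.coe_le_coe.2 ((M.closure_subset_closure (Set.empty_subset F.1)).trans F.2.closure.le)

theorem pointFlat_le_iff {i : α} (hi : i ∈ M.E) (F : Flats M) : pointFlat M i ≤ F ↔ i ∈ F.1 := by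
  rw [pointFlat, WithBot.coe_le_coe]
  refine ⟨fun h => h (M.mem_closure_self i hi), fun h => ?_⟩
  exact (M.closure_subset_closure (Set.singleton_subset_iff.2 h)).trans F.2.closure.le

theorem botRank_loopFlat : botRank M (loopFlat M) = 1 := by
  simp [loopFlat, natRank_closure, natRank_empty]

end Chow

end ChowBasis

/-! ### The Chow ring -/

namespace ChowBasis

open MvPolynomial

section Chow

variable {α : Type*} {M : Matroid α}

/-- A nonempty proper flat as an element of the lattice of flats with an added bottom. -/
def ofNonemptyProper (F : M.NonemptyProperFlat) : WithBot (Flats M) :=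
  ((⟨F.1, F.2.1⟩ : Flats M) : WithBot (Flats M))

theorem ofNonemptyProper_injective :
    Function.Injective (ofNonemptyProper : M.NonemptyProperFlat → WithBot (Flats M)) := by
  intro F G h
  have := WithBot.coe_injective h
  exact Subtype.ext (congrArg (fun F : Flats M => F.1) this)

theorem coe_le_ofNonemptyProper {F : Flats M} {G : M.NonemptyProperFlat} :
    (F : WithBot (Flats M)) ≤ ofNonemptyProper G ↔ F.1 ⊆ G.1 := WithBot.coe_le_coe

theorem ofNonemptyProper_le_iff {F G : M.NonemptyProperFlat} :
    ofNonemptyProper F ≤ ofNonemptyProper G ↔ F.1 ⊆ G.1 := WithBot.coe_le_coe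

theorem exists_ofNonemptyProper {F : Flats M} (h : F.1 ≠ ∅) :
    (F : WithBot (Flats M)) = topFlat M ∨ ∃ G : M.NonemptyProperFlat,
      ofNonemptyProper G = (F : WithBot (Flats M)) := by
  by_cases hE : F.1 = M.E
  · exact .inl (congrArg _ (Subtype.ext hE))
  · exact .inr ⟨⟨F.1, F.2, h, hE⟩, rfl⟩

theorem ofNonemptyProper_ne_topFlat (F : M.NonemptyProperFlat) :
    ofNonemptyProper F ≠ topFlat M := fun h =>
  F.2.2.2 (congrArg Subtype.val (WithBot.coe_injective h))

theorem closure_empty_eq_empty [M.Loopless] : M.closure ∅ = ∅ := by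
  rw [← Matroid.loops, Matroid.loops_eq_empty]

theorem loopFlat_lt_iff [M.Loopless] {F : Flats M} : loopFlat M < F ↔ F.1 ≠ ∅ := by
  rw [lt_iff_le_and_ne, and_iff_right (loopFlat_le F), loopFlat, Ne, WithBot.coe_inj, not_iff_not,
    Subtype.ext_iff, eq_comm]
  change F.1 = M.closure ∅ ↔ _
  rw [closure_empty_eq_empty]

variable [M.Finite]

theorem isHomogeneous_sumContaining (i : α) : (M.sumContaining i).IsHomogeneous 1 :=
  IsHomogeneous.sum _ _ _ fun F _ => isHomogeneous_X ℚ F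

open scoped Classical in
/-- The linear form by which a variable of the larger polynomial ring is expressed in the variables
of the Chow ring: `x_∅` and the variable of the added bottom vanish, and
`x_E = - ∑_{F ∋ i} x_F` for a chosen element `i ∈ E`. -/
noncomputable def chowForm (M : Matroid α) [M.Finite] :
    WithBot (Flats M) → MvPolynomial M.NonemptyProperFlat ℚ :=
  WithBot.recBotCoe 0 fun F =>
    if h : F.1 ≠ ∅ ∧ F.1 ≠ M.E then X ⟨F.1, F.2, h⟩
    else if h : F.1.Nonempty then - M.sumContaining h.some else 0

theorem isHomogeneous_chowForm (F : WithBot (Flats M)) : (chowForm M F).IsHomogeneous 1 := by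
  induction F with
  | bot => exact isHomogeneous_zero _ _ _
  | coe F =>
    simp only [chowForm, WithBot.recBotCoe_coe]
    split_ifs
    · exact isHomogeneous_X _ _
    · exact (isHomogeneous_sumContaining _).neg
    · exact isHomogeneous_zero _ _ _

theorem chowForm_ofNonemptyProper (F : M.NonemptyProperFlat) :
    chowForm M (ofNonemptyProper F) = X F := by
  simp [chowForm, ofNonemptyProper, F.2.2.1, F.2.2.2]

theorem chowForm_topFlat (h : M.E.Nonempty) :
    chowForm M (topFlat M) = - M.sumContaining h.some := by
  simp [chowForm, topFlat, h]

theorem X_mul_X_mem_chowIdeal {F G : M.NonemptyProperFlat} (h₁ : ¬ F.1 ⊆ G.1)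
    (h₂ : ¬ G.1 ⊆ F.1) : X F * X G ∈ M.chowIdeal :=
  Ideal.mem_sup_left (Ideal.subset_span ⟨F, G, h₁, h₂, rfl⟩)

theorem sumContaining_sub_mem_chowIdeal {i j : α} (hi : i ∈ M.E) (hj : j ∈ M.E) :
    M.sumContaining i - M.sumContaining j ∈ M.chowIdeal :=
  Ideal.mem_sup_right (Ideal.subset_span ⟨i, hi, j, hj, rfl⟩)

open scoped Classical in
/-- The variable of `E` occurs in `h_G` but not in the sums of the Chow ring. -/
theorem aeval_sumContaining {i : α} (hi : i ∈ M.E) :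
    aeval (fun F => X (ofNonemptyProper F)) (M.sumContaining i) =
      (hsum (pointFlat M i) - X (topFlat M) : MvPolynomial (WithBot (Flats M)) ℚ) := by
  rw [hsum, Matroid.sumContaining, eq_sub_iff_add_eq, add_comm, map_sum]
  simp only [aeval_X]
  refine (sum_filter_eq_add_sum_comp ofNonemptyProper_injective ofNonemptyProper_ne_topFlat
    (p := fun H => pointFlat M i ≤ H) (q := fun F => i ∈ F.1) (le_topFlat _)
    (fun F => (pointFlat_le_iff hi ⟨F.1, F.2.1⟩).symm) ?_ X).symm
  intro t ht
  induction t with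
  | bot => exact (WithBot.not_coe_le_bot _ ht).elim
  | coe F => exact exists_ofNonemptyProper (Set.nonempty_iff_ne_empty.1
      ⟨i, (pointFlat_le_iff hi F).1 ht⟩)

open scoped Classical in
theorem aeval_chowForm_hsum {G : Flats M} (hG : G.1 ≠ ∅) (hE : M.E.Nonempty) :
    aeval (chowForm M) (hsum (G : WithBot (Flats M))) =
      ∑ F : M.NonemptyProperFlat with G.1 ⊆ F.1, X F - M.sumContaining hE.some := by
  rw [hsum, sum_filter_eq_add_sum_comp ofNonemptyProper_injective ofNonemptyProper_ne_topFlat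
    (p := fun H => (G : WithBot (Flats M)) ≤ H) (q := fun F => G.1 ⊆ F.1) (le_topFlat _)
    (fun F => coe_le_ofNonemptyProper.symm), map_add, aeval_X,
    chowForm_topFlat hE, map_sum]
  · simp only [aeval_X, chowForm_ofNonemptyProper]
    ring
  · intro t ht
    induction t with
    | bot => simp at ht
    | coe F =>
      refine exists_ofNonemptyProper fun h => hG (Set.subset_empty_iff.1 ?_)
      rw [← h]
      exact (WithBot.coe_le_coe.1 ht : G ≤ F)

variable [M.Loopless]

theorem chowForm_of_not_lt {F : WithBot (Flats M)} (h : ¬ loopFlat M < F) : chowForm M F = 0 := by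
  induction F with
  | bot => rfl
  | coe F =>
    rw [loopFlat_lt_iff, not_not] at h
    simp [chowForm, h]

theorem hsum_pointFlat_mem {i : α} (hi : i ∈ M.E) :
    hsum (pointFlat M i) ∈ relIdeal (botRank M) (loopFlat M) (Set.Ioi (loopFlat M)) := by
  have hlt : loopFlat M < pointFlat M i :=
    loopFlat_lt_iff.2 (Set.nonempty_iff_ne_empty.1 ⟨i, M.mem_closure_self i hi⟩)
  have := (ChowRel.base (ρ := botRank M) (B := loopFlat M) (pointFlat M i) hlt).mem
  have hr : botRank M (pointFlat M i) = 2 := by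
    rw [pointFlat, botRank_coe, natRank_closure, natRank, M.eRk_singleton_eq hi]
    rfl
  rwa [hr, botRank_loopFlat, show 2 - 1 = 1 from rfl, pow_one] at this

theorem chowIdeal_le : M.chowIdeal ≤
    (relIdeal (botRank M) (loopFlat M) (Set.Ioi (loopFlat M))).comap
      (aeval fun F => X (ofNonemptyProper F)) := by
  refine sup_le (Ideal.span_le.2 ?_) (Ideal.span_le.2 ?_)
  · rintro _ ⟨F, G, h₁, h₂, rfl⟩
    rw [SetLike.mem_coe, Ideal.mem_comap, map_mul, aeval_X, aeval_X]
    exact (ChowRel.incomp _ _ (fun h => h₁ (ofNonemptyProper_le_iff.1 h))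
      fun h => h₂ (ofNonemptyProper_le_iff.1 h)).mem
  · rintro _ ⟨i, hi, j, hj, rfl⟩
    rw [SetLike.mem_coe, Ideal.mem_comap, map_sub, aeval_sumContaining hi, aeval_sumContaining hj,
      sub_sub_sub_cancel_right]
    exact Ideal.sub_mem _ (hsum_pointFlat_mem hi) (hsum_pointFlat_mem hj)

theorem relIdeal_le_comap_chowIdeal :
    relIdeal (botRank M) (loopFlat M) (Set.Ioi (loopFlat M)) ≤
      M.chowIdeal.comap (aeval (chowForm M)) := by
  classical
  refine relIdeal_Ioi_le isRank_botRank ?_ ?_ ?_ ?_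
  · intro G hG
    simp [chowForm_of_not_lt hG]
  · intro F G h₁ h₂
    rw [Ideal.mem_comap, map_mul, aeval_X, aeval_X]
    induction F with
    | bot => exact (h₁ bot_le).elim
    | coe F =>
    induction G with
    | bot => exact (h₂ bot_le).elim
    | coe G =>
    have hF : F.1 ≠ ∅ := fun h => h₁ (WithBot.coe_le_coe.2 (by
      change F.1 ⊆ G.1
      rw [h]; exact Set.empty_subset _))
    have hG : G.1 ≠ ∅ := fun h => h₂ (WithBot.coe_le_coe.2 (by
      change G.1 ⊆ F.1
      rw [h]; exact Set.empty_subset _))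
    obtain ⟨F', hF'⟩ := (exists_ofNonemptyProper hF).resolve_left
      fun h => h₂ (h ▸ le_topFlat _)
    obtain ⟨G', hG'⟩ := (exists_ofNonemptyProper hG).resolve_left
      fun h => h₁ (h ▸ le_topFlat _)
    rw [← hF', ← hG'] at h₁ h₂ ⊢
    rw [chowForm_ofNonemptyProper, chowForm_ofNonemptyProper]
    exact X_mul_X_mem_chowIdeal (fun h => h₁ (ofNonemptyProper_le_iff.2 h))
      fun h => h₂ (ofNonemptyProper_le_iff.2 h)
  · intro G hG hr
    induction G with
    | bot => exact (not_lt_bot hG).elim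
    | coe G =>
    have hG0 := loopFlat_lt_iff.1 hG
    obtain ⟨e, he⟩ := Set.nonempty_iff_ne_empty.2 hG0
    have heE := G.2.subset_ground he
    rw [Ideal.mem_comap, aeval_chowForm_hsum hG0 ⟨e, heE⟩]
    have hsub (F : M.NonemptyProperFlat) : G.1 ⊆ F.1 ↔ e ∈ F.1 := by
      rw [subset_iff_of_natRank_eq_succ (M.isFlat_closure ∅) G.2 F.2.1 (e := e)
        (by rw [closure_empty_eq_empty]; exact Set.empty_subset _) ?_ he (by rw [closure_empty_eq_empty]; simp)]
      · rw [closure_empty_eq_empty]; simp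
      · simpa [loopFlat] using hr
    simp only [hsub]
    exact sumContaining_sub_mem_chowIdeal heE (Set.Nonempty.some_mem ⟨e, heE⟩)
  · intro F G hBF hFG hr
    induction G with
    | bot => exact (not_lt_bot hFG).elim
    | coe G =>
    induction F with
    | bot => exact (not_lt_bot hBF).elim
    | coe F =>
    have hFG' : F < G := WithBot.coe_lt_coe.1 hFG
    have hF0 := loopFlat_lt_iff.1 hBF
    have hG0 := loopFlat_lt_iff.1 (hBF.trans hFG)
    obtain ⟨F', hF'⟩ := (exists_ofNonemptyProper hF0).resolve_left
      fun h => ((h ▸ hFG).trans_le (le_topFlat _)).false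
    obtain ⟨hle, e, he, heF⟩ := Set.ssubset_iff_exists.1 (show F.1 ⊂ G.1 from hFG')
    have heE := G.2.subset_ground he
    have hFF' : F'.1 = F.1 := congrArg Subtype.val (WithBot.coe_injective hF')
    have hsub (H : M.NonemptyProperFlat) : G.1 ⊆ H.1 ↔ e ∈ H.1 ∧ F'.1 ⊆ H.1 := by
      rw [hFF', and_comm]
      exact subset_iff_of_natRank_eq_succ F.2 G.2 H.2.1 hle (by simpa using hr) he heF
    rw [Ideal.mem_comap, map_mul, aeval_X, aeval_chowForm_hsum hG0 ⟨e, heE⟩, ← hF',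
      chowForm_ofNonemptyProper]
    -- Modulo products of incomparable variables, multiplying by `x_F` turns `∑_{H ∋ e} x_H` into
    -- `∑_{H ⊇ G} x_H`.
    have hdiff : (X F' : MvPolynomial M.NonemptyProperFlat ℚ) *
        (M.sumContaining e - ∑ H : M.NonemptyProperFlat with G.1 ⊆ H.1, X H) ∈ M.chowIdeal := by
      have : M.sumContaining e - ∑ H : M.NonemptyProperFlat with G.1 ⊆ H.1, X H =
          ∑ H : M.NonemptyProperFlat with e ∈ H.1 ∧ ¬ F'.1 ⊆ H.1, X H := by
        rw [Matroid.sumContaining, sub_eq_iff_eq_add, ← Finset.sum_filter_add_sum_filter_not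
          (Finset.univ.filter fun H : M.NonemptyProperFlat => e ∈ H.1) (fun H => F'.1 ⊆ H.1),
          add_comm, Finset.filter_filter, Finset.filter_filter]
        simp only [hsub]
      rw [this, Finset.mul_sum]
      refine Ideal.sum_mem _ fun H hH => ?_
      simp only [Finset.mem_filter, Finset.mem_univ, true_and] at hH
      exact X_mul_X_mem_chowIdeal hH.2 fun h => heF (hFF' ▸ h hH.1)
    have hE : M.E.Nonempty := ⟨e, heE⟩
    have := Ideal.sub_mem _ (Ideal.mul_mem_left _ (X F')
      (sumContaining_sub_mem_chowIdeal heE hE.some_mem)) hdiff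
    convert this using 1
    ring

/-- The Chow ring is the ring attached to the base `∅`. -/
theorem chowSeries_eq (j : ℕ) :
    PowerSeries.coeff j M.chowSeries = ((fyPoly (botRank M) (loopFlat M)).coeff j : ℤ) := by
  rw [Matroid.chowSeries, Matroid.hilbertSeries, PowerSeries.coeff_mk,
    ← (hasGradedBasis_Ioi isRank_botRank (loopFlat M)).finrank_eq j, Nat.cast_inj]
  refine finrank_quotientPiece_eq (fun F => isHomogeneous_X _ _) isHomogeneous_chowForm
    chowIdeal_le relIdeal_le_comap_chowIdeal ?_ ?_ j
  · intro t
    by_cases ht : loopFlat M < t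
    · induction t with
      | bot => exact (not_lt_bot ht).elim
      | coe F =>
      rcases exists_ofNonemptyProper (loopFlat_lt_iff.1 ht) with h | ⟨G, hG⟩
      · have hE : M.E.Nonempty := by
          obtain ⟨e, he⟩ := Set.nonempty_iff_ne_empty.2 (loopFlat_lt_iff.1 ht)
          exact ⟨e, F.2.subset_ground he⟩
        rw [h, chowForm_topFlat hE, map_neg, aeval_sumContaining hE.some_mem]
        convert (Ideal.neg_mem_iff _).2 (hsum_pointFlat_mem hE.some_mem) using 1
        ring
      · rw [← hG, chowForm_ofNonemptyProper, aeval_X, sub_self]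
        exact Ideal.zero_mem _
    · rw [chowForm_of_not_lt ht, map_zero, zero_sub]
      exact (Ideal.neg_mem_iff _).2 (ChowRel.var t ht).mem
  · intro F
    simp [chowForm_ofNonemptyProper]

end Chow

end ChowBasis

/-! ### The augmented Chow ring -/

namespace ChowBasis

open MvPolynomial

section Augmented

variable {α : Type*} {M : Matroid α}

/-- A proper flat as an element of the lattice of flats with an added bottom. -/
def ofProper (F : M.ProperFlat) : WithBot (Flats M) :=
  ((⟨F.1, F.2.1⟩ : Flats M) : WithBot (Flats M))

theorem ofProper_injective :
    Function.Injective (ofProper : M.ProperFlat → WithBot (Flats M)) := by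
  intro F G h
  have := WithBot.coe_injective h
  exact Subtype.ext (congrArg (fun F : Flats M => F.1) this)

theorem coe_le_ofProper {F : Flats M} {G : M.ProperFlat} :
    (F : WithBot (Flats M)) ≤ ofProper G ↔ F.1 ⊆ G.1 := WithBot.coe_le_coe

theorem ofProper_le_iff {F G : M.ProperFlat} :
    ofProper F ≤ ofProper G ↔ F.1 ⊆ G.1 := WithBot.coe_le_coe

theorem exists_ofProper (F : Flats M) :
    (F : WithBot (Flats M)) = topFlat M ∨ ∃ G : M.ProperFlat,
      ofProper G = (F : WithBot (Flats M)) := by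
  by_cases hE : F.1 = M.E
  · exact .inl (congrArg _ (Subtype.ext hE))
  · exact .inr ⟨⟨F.1, F.2, hE⟩, rfl⟩

theorem ofProper_ne_topFlat (F : M.ProperFlat) : ofProper F ≠ topFlat M := fun h =>
  F.2.2 (congrArg Subtype.val (WithBot.coe_injective h))

theorem isHomogeneous_augX (F : M.ProperFlat) : (M.augX F).IsHomogeneous 1 := isHomogeneous_X _ _

variable [M.Finite]

open scoped Classical in
/-- The linear form by which a variable of the augmented Chow ring is expressed in the variables
attached to flats: `x_F` is kept and `y_i = ∑_{F ∌ i} x_F`. -/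
noncomputable def augVarForm (M : Matroid α) [M.Finite] :
    M.AugVar → MvPolynomial (WithBot (Flats M)) ℚ :=
  Sum.elim (fun F => X (ofProper F))
    fun i => ∑ F : M.ProperFlat with i.1 ∉ F.1, X (ofProper F)

open scoped Classical in
/-- The linear form by which a variable attached to a flat is expressed in the variables of the
augmented Chow ring: the variable of the added bottom vanishes and `x_E = - ∑_{F ≠ E} x_F`. -/
noncomputable def augChowForm (M : Matroid α) [M.Finite] :
    WithBot (Flats M) → MvPolynomial M.AugVar ℚ :=
  WithBot.recBotCoe 0 fun F =>
    if h : F.1 ≠ M.E then M.augX ⟨F.1, F.2, h⟩ else - ∑ G, M.augX G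

theorem isHomogeneous_augVarForm (s : M.AugVar) : (augVarForm M s).IsHomogeneous 1 := by
  rcases s with F | i
  · exact isHomogeneous_X _ _
  · exact IsHomogeneous.sum _ _ _ fun F _ => isHomogeneous_X _ _

theorem isHomogeneous_augChowForm (F : WithBot (Flats M)) :
    (augChowForm M F).IsHomogeneous 1 := by
  induction F with
  | bot => exact isHomogeneous_zero _ _ _
  | coe F =>
    simp only [augChowForm, WithBot.recBotCoe_coe]
    split_ifs
    · exact isHomogeneous_augX _
    · exact (IsHomogeneous.sum _ _ _ fun F _ => isHomogeneous_augX F).neg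

theorem augChowForm_ofProper (F : M.ProperFlat) : augChowForm M (ofProper F) = M.augX F := by
  simp [augChowForm, ofProper, F.2.2]

theorem augChowForm_topFlat : augChowForm M (topFlat M) = - ∑ G, M.augX G := by
  simp [augChowForm, topFlat]

theorem aeval_augVarForm_augX (F : M.ProperFlat) :
    aeval (augVarForm M) (M.augX F) = X (ofProper F) := by
  rw [Matroid.augX, aeval_X]; rfl

open scoped Classical in
theorem hsum_coe_eq (G : Flats M) : hsum (G : WithBot (Flats M)) =
    X (topFlat M) + ∑ F : M.ProperFlat with G.1 ⊆ F.1, X (ofProper F) := by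
  rw [hsum, sum_filter_eq_add_sum_comp ofProper_injective ofProper_ne_topFlat
    (p := fun H => (G : WithBot (Flats M)) ≤ H) (q := fun F => G.1 ⊆ F.1) (le_topFlat _)
    (fun F => coe_le_ofProper.symm)]
  intro t ht
  induction t with
  | bot => exact (WithBot.not_coe_le_bot _ ht).elim
  | coe F => exact exists_ofProper F

open scoped Classical in
theorem aeval_augChowForm_hsum (G : Flats M) :
    aeval (augChowForm M) (hsum (G : WithBot (Flats M))) =
      - ∑ F : M.ProperFlat with ¬ G.1 ⊆ F.1, M.augX F := by
  rw [hsum_coe_eq, map_add, map_sum, aeval_X, augChowForm_topFlat]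
  simp only [aeval_X, augChowForm_ofProper]
  rw [← Finset.sum_filter_add_sum_filter_not Finset.univ
    (fun F : M.ProperFlat => G.1 ⊆ F.1) M.augX]
  ring

theorem hsum_loopFlat : hsum (loopFlat M) =
    X (topFlat M) + ∑ F : M.ProperFlat, X (ofProper F) := by
  classical
  rw [loopFlat, hsum_coe_eq, Finset.filter_true_of_mem]
  intro F _
  exact (M.closure_subset_closure (Set.empty_subset F.1)).trans F.2.1.closure.le

theorem hsum_loopFlat_mem :
    hsum (loopFlat M) ∈ relIdeal (botRank M) ⊥ (Set.Ioi (⊥ : WithBot (Flats M))) := by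
  have := (ChowRel.base (ρ := botRank M) (B := ⊥) (P := Set.Ioi (⊥ : WithBot (Flats M)))
    (loopFlat M) (WithBot.bot_lt_coe _)).mem
  rwa [botRank_loopFlat, botRank_bot, tsub_zero, pow_one] at this

/-- Since `h_∅ = 0` in the ring attached to the base `⊥`, the variable `y_i` becomes `-h_G` there,
where `G` is the flat spanned by `i`. -/
theorem augVarForm_inr (i : M.E) :
    augVarForm M (Sum.inr i) = hsum (loopFlat M) - hsum (pointFlat M i.1) := by
  classical
  rw [hsum_loopFlat, pointFlat, hsum_coe_eq, add_sub_add_left_eq_sub, eq_sub_iff_add_eq, add_comm,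
    ← Finset.sum_filter_add_sum_filter_not Finset.univ (fun F : M.ProperFlat => i.1 ∈ F.1)]
  congr 1
  refine Finset.sum_congr (Finset.filter_congr fun F _ => ?_) fun _ _ => rfl
  have := pointFlat_le_iff i.2 ⟨F.1, F.2.1⟩
  rwa [pointFlat, WithBot.coe_le_coe] at this

theorem augX_mul_augX_mem {F G : M.ProperFlat} (h₁ : ¬ F.1 ⊆ G.1) (h₂ : ¬ G.1 ⊆ F.1) :
    M.augX F * M.augX G ∈ M.augChowIdeal :=
  Ideal.mem_sup_right (Ideal.mem_sup_left (Ideal.subset_span ⟨F, G, h₁, h₂, rfl⟩))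

theorem augY_mul_augX_mem {i : M.E} {F : M.ProperFlat} (h : i.1 ∉ F.1) :
    M.augY i * M.augX F ∈ M.augChowIdeal :=
  Ideal.mem_sup_right (Ideal.mem_sup_right (Ideal.subset_span ⟨i, F, h, rfl⟩))

theorem augY_sub_mem (i : M.E) : M.augY i - M.augSumAvoiding i ∈ M.augChowIdeal :=
  Ideal.mem_sup_left (Ideal.subset_span ⟨i, rfl⟩)

theorem aeval_augSumAvoiding (i : M.E) :
    aeval (augVarForm M) (M.augSumAvoiding i) = augVarForm M (Sum.inr i) := by
  rw [Matroid.augSumAvoiding, map_sum]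
  simp only [aeval_augVarForm_augX]
  rfl

theorem aeval_augVarForm_inr (i : M.E) :
    aeval (augChowForm M) (augVarForm M (Sum.inr i)) = M.augSumAvoiding i := by
  simp only [augVarForm, Sum.elim_inr, map_sum, aeval_X, augChowForm_ofProper]
  rfl

theorem augChowIdeal_le : M.augChowIdeal ≤
    (relIdeal (botRank M) ⊥ (Set.Ioi (⊥ : WithBot (Flats M)))).comap (aeval (augVarForm M)) := by
  refine sup_le (Ideal.span_le.2 ?_) (sup_le (Ideal.span_le.2 ?_) (Ideal.span_le.2 ?_))
  · rintro _ ⟨i, rfl⟩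
    rw [SetLike.mem_coe, Ideal.mem_comap, map_sub, aeval_augSumAvoiding, Matroid.augY, aeval_X,
      sub_self]
    exact Ideal.zero_mem _
  · rintro _ ⟨F, G, h₁, h₂, rfl⟩
    rw [SetLike.mem_coe, Ideal.mem_comap, map_mul, aeval_augVarForm_augX, aeval_augVarForm_augX]
    exact (ChowRel.incomp _ _ (fun h => h₁ (ofProper_le_iff.1 h))
      fun h => h₂ (ofProper_le_iff.1 h)).mem
  · rintro _ ⟨i, F, hi, rfl⟩
    rw [SetLike.mem_coe, Ideal.mem_comap, map_mul, aeval_augVarForm_augX, Matroid.augY, aeval_X,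
      augVarForm_inr, sub_mul]
    refine Ideal.sub_mem _ (Ideal.mul_mem_right _ _ hsum_loopFlat_mem) ?_
    have hle : ¬ pointFlat M i.1 ≤ ofProper F := fun h =>
      hi ((pointFlat_le_iff i.2 ⟨F.1, F.2.1⟩).1 h)
    have := X_mul_hsum_pow_mem (ρ := botRank M) (B := ⊥) (P := Set.Ioi (⊥ : WithBot (Flats M)))
      (isUpperSet_Ioi _) (G := pointFlat M i.1) (H := ofProper F) (WithBot.bot_lt_coe _) hle
      (m := 1) ?_
    · rwa [pow_one, mul_comm] at this
    · have h1 := isRank_botRank.submodular (loopFlat M) (pointFlat M i.1) (ofProper F)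
        (loopFlat_le _) (loopFlat_le _)
      have h2 : botRank M (pointFlat M i.1) ≤ 2 := by
        have := M.eRk_singleton_le i.1
        rw [← coe_natRank] at this
        rw [pointFlat, botRank_coe, natRank_closure]
        have : natRank M {i.1} ≤ 1 := by exact_mod_cast this
        omega
      rw [botRank_loopFlat] at h1
      omega

theorem relIdeal_le_comap_augChowIdeal :
    relIdeal (botRank M) ⊥ (Set.Ioi (⊥ : WithBot (Flats M))) ≤
      M.augChowIdeal.comap (aeval (augChowForm M)) := by
  classical
  refine relIdeal_Ioi_le isRank_botRank ?_ ?_ ?_ ?_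
  · intro G hG
    rw [bot_lt_iff_ne_bot, not_not] at hG
    subst hG
    rw [Ideal.mem_comap, aeval_X]
    exact Ideal.zero_mem _
  · intro F G h₁ h₂
    rw [Ideal.mem_comap, map_mul, aeval_X, aeval_X]
    induction F with
    | bot => exact (h₁ bot_le).elim
    | coe F =>
    induction G with
    | bot => exact (h₂ bot_le).elim
    | coe G =>
    obtain ⟨F', hF'⟩ := (exists_ofProper F).resolve_left fun h => h₂ (h ▸ le_topFlat _)
    obtain ⟨G', hG'⟩ := (exists_ofProper G).resolve_left fun h => h₁ (h ▸ le_topFlat _)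
    rw [← hF', ← hG'] at h₁ h₂ ⊢
    rw [augChowForm_ofProper, augChowForm_ofProper]
    exact augX_mul_augX_mem (fun h => h₁ (ofProper_le_iff.2 h))
      fun h => h₂ (ofProper_le_iff.2 h)
  · intro G hG hr
    induction G with
    | bot => exact (lt_irrefl _ hG).elim
    | coe G =>
    -- The only flat of rank zero is contained in all flats.
    have hG0 (F : M.ProperFlat) : G.1 ⊆ F.1 := by
      have hcl : M.closure ∅ = G.1 := by
        refine eq_of_natRank_le (M.isFlat_closure ∅) G.2
          ((M.closure_subset_closure (Set.empty_subset G.1)).trans G.2.closure.le) ?_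
        have : natRank M G.1 = 0 := by simpa using hr
        omega
      rw [← hcl]
      exact (M.closure_subset_closure (Set.empty_subset F.1)).trans F.2.1.closure.le
    rw [Ideal.mem_comap, aeval_augChowForm_hsum]
    simp [hG0]
  · intro F G hBF hFG hr
    induction G with
    | bot => exact (not_lt_bot hFG).elim
    | coe G =>
    induction F with
    | bot => exact (lt_irrefl _ hBF).elim
    | coe F =>
    have hFG' : F < G := WithBot.coe_lt_coe.1 hFG
    obtain ⟨F', hF'⟩ := (exists_ofProper F).resolve_left
      fun h => ((h ▸ hFG).trans_le (le_topFlat _)).false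
    obtain ⟨hle, e, he, heF⟩ := Set.ssubset_iff_exists.1 (show F.1 ⊂ G.1 from hFG')
    have heE := G.2.subset_ground he
    have hFF' : F'.1 = F.1 := congrArg Subtype.val (WithBot.coe_injective hF')
    have hsub (H : M.ProperFlat) : G.1 ⊆ H.1 ↔ F'.1 ⊆ H.1 ∧ e ∈ H.1 := by
      rw [hFF']
      exact subset_iff_of_natRank_eq_succ F.2 G.2 H.2.1 hle (by simpa using hr) he heF
    rw [Ideal.mem_comap, map_mul, aeval_X, aeval_augChowForm_hsum, ← hF', augChowForm_ofProper,
      mul_neg, Ideal.neg_mem_iff]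
    -- The flats not containing `G` either avoid `e` or are incomparable to `F`.
    have hsplit : ∑ H : M.ProperFlat with ¬ G.1 ⊆ H.1, M.augX H = M.augSumAvoiding ⟨e, heE⟩ +
        ∑ H : M.ProperFlat with e ∈ H.1 ∧ ¬ F'.1 ⊆ H.1, M.augX H := by
      rw [Matroid.augSumAvoiding, ← Finset.sum_filter_add_sum_filter_not
        (Finset.univ.filter fun H : M.ProperFlat => ¬ G.1 ⊆ H.1) (fun H => e ∉ H.1),
        Finset.filter_filter, Finset.filter_filter]
      congr 1 <;>
      · refine Finset.sum_congr (Finset.filter_congr fun H _ => ?_) fun _ _ => rfl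
        simp only [hsub]
        tauto
    have hy : M.augX F' * M.augSumAvoiding ⟨e, heE⟩ ∈ M.augChowIdeal := by
      have h1 := augY_mul_augX_mem (i := ⟨e, heE⟩) (F := F') (by rwa [hFF'])
      have h2 := Ideal.mul_mem_left _ (M.augX F') (augY_sub_mem ⟨e, heE⟩)
      convert Ideal.sub_mem _ h1 h2 using 1
      ring
    rw [hsplit, mul_add, Finset.mul_sum]
    refine Ideal.add_mem _ hy (Ideal.sum_mem _ fun H hH => ?_)
    simp only [Finset.mem_filter, Finset.mem_univ, true_and] at hH
    exact augX_mul_augX_mem hH.2 fun h => heF (hFF' ▸ h hH.1)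

/-- The augmented Chow ring is the ring attached to the added bottom element. -/
theorem augChowSeries_eq (j : ℕ) : PowerSeries.coeff j M.augChowSeries =
    ((fyPoly (botRank M) (⊥ : WithBot (Flats M))).coeff j : ℤ) := by
  have : Finite M.E := M.ground_finite
  rw [Matroid.augChowSeries, Matroid.hilbertSeries, PowerSeries.coeff_mk,
    ← (hasGradedBasis_Ioi isRank_botRank (⊥ : WithBot (Flats M))).finrank_eq j, Nat.cast_inj]
  refine finrank_quotientPiece_eq isHomogeneous_augVarForm isHomogeneous_augChowForm
    augChowIdeal_le relIdeal_le_comap_augChowIdeal ?_ ?_ j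
  · intro t
    induction t with
    | bot =>
      simp only [augChowForm, WithBot.recBotCoe_bot, map_zero, zero_sub]
      exact (Ideal.neg_mem_iff _).2 (ChowRel.var ⊥ (lt_irrefl _)).mem
    | coe F =>
      rcases exists_ofProper F with h | ⟨G, hG⟩
      · rw [h, augChowForm_topFlat, map_neg, map_sum]
        simp only [aeval_augVarForm_augX]
        convert (Ideal.neg_mem_iff _).2 (hsum_loopFlat_mem (M := M)) using 1
        rw [hsum_loopFlat]
        ring
      · rw [← hG, augChowForm_ofProper, aeval_augVarForm_augX, sub_self]
        exact Ideal.zero_mem _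
  · rintro (F | i)
    · simp [augVarForm, augChowForm_ofProper, Matroid.augX]
    · rw [aeval_augVarForm_inr, ← Ideal.neg_mem_iff, neg_sub]
      exact augY_sub_mem i

end Augmented

end ChowBasis

/-! ### Comparison with the uniform matroid -/

namespace ChowBasis

section Uniform

variable {k n : ℕ}

theorem natRank_uniform_of_ncard_le {X : Set (Fin n)} (hX : X.ncard ≤ k) :
    natRank (Matroid.uniform k n) X = X.ncard := by
  rw [natRank, (Matroid.uniform_indep_iff.2 hX).eRk_eq_encard, Set.ncard]

theorem isFlat_uniform_of_ncard_lt {X : Set (Fin n)} (hX : X.ncard < k) :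
    (Matroid.uniform k n).IsFlat X := by
  rw [Matroid.isFlat_iff_closure_eq]
  have hind : (Matroid.uniform k n).Indep X := Matroid.uniform_indep_iff.2 hX.le
  refine subset_antisymm (fun e he => ?_) ((Matroid.uniform k n).subset_closure X)
  by_contra heX
  refine ((hind.mem_closure_iff_of_notMem heX).1 he).not_indep (Matroid.uniform_indep_iff.2 ?_)
  rw [Set.ncard_insert_of_notMem heX]
  exact hX

theorem natRank_le_of_ncard_le {X : Set (Fin n)} (hX : k ≤ X.ncard) :
    k ≤ natRank (Matroid.uniform k n) X := by
  obtain ⟨I, hIX, hI⟩ := Set.exists_subset_card_eq hX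
  calc k = natRank (Matroid.uniform k n) I := by rw [natRank_uniform_of_ncard_le hI.le, hI]
    _ ≤ natRank (Matroid.uniform k n) X := natRank_mono hIX

theorem natRank_uniform_le (X : Set (Fin n)) : natRank (Matroid.uniform k n) X ≤ k := by
  obtain ⟨I, hI⟩ := (Matroid.uniform k n).exists_isBasis' X
  rw [natRank, hI.eRk_eq_encard]
  exact Matroid.uniform_indep_iff.1 hI.indep

theorem ncard_eq_natRank {X : Set (Fin n)} (h : natRank (Matroid.uniform k n) X < k) :
    X.ncard = natRank (Matroid.uniform k n) X := by
  refine (natRank_uniform_of_ncard_le (k := k) ?_).symm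
  by_contra hlt
  exact h.not_ge (natRank_le_of_ncard_le (not_le.1 hlt).le)

variable {α : Type*} {M : Matroid α} [M.Finite]

/-- Bases of the flats above `F` that extend a fixed basis `I` of `F` are determined by subsets of
`M.E \ I`. Sending these to subsets of the complement of `F'` maps the flats above `F` injectively,
and preserving ranks, to flats of the uniform matroid above `F'`. -/
theorem exists_injOn_flats (hk : M.eRank = (k : ℕ∞)) (hn : M.E.ncard = n) (F : Flats M)
    (F' : Flats (Matroid.uniform k n))
    (hr : natRank M F.1 = natRank (Matroid.uniform k n) F'.1) :
    ∃ φ : Flats M → Flats (Matroid.uniform k n), Set.InjOn φ (Set.Ici F) ∧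
      ∀ G, F ≤ G → F' ≤ φ G ∧ natRank (Matroid.uniform k n) (φ G).1 = natRank M G.1 := by
  classical
  have hME : natRank M M.E = k := by rw [natRank, M.eRk_ground, hk]; rfl
  have hle (G : Flats M) : natRank M G.1 ≤ k := hME ▸ natRank_mono G.2.subset_ground
  have htop {G : Flats M} (hG : ¬ natRank M G.1 < k) : G.1 = M.E :=
    eq_of_natRank_le G.2 M.ground_isFlat G.2.subset_ground (by rw [hME]; exact not_lt.1 hG)
  have hkn : k ≤ n := by
    have := M.eRank_le_encard_ground
    rw [hk, ← M.ground_finite.cast_ncard_eq, hn] at this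
    exact_mod_cast this
  have hUE : natRank (Matroid.uniform k n) Set.univ = k :=
    le_antisymm (natRank_uniform_le _) (natRank_le_of_ncard_le (by simpa using hkn))
  let top : Flats (Matroid.uniform k n) := ⟨Set.univ, (Matroid.uniform k n).ground_isFlat⟩
  obtain ⟨I, hI⟩ := M.exists_isBasis F.1 F.2.subset_ground
  have hIr : I.ncard = natRank M F.1 := by rw [natRank, hI.eRk_eq_encard, Set.ncard]
  have hJ (G : Flats M) (hG : F ≤ G) : ∃ J, M.IsBasis J G.1 ∧ I ⊆ J :=
    hI.indep.subset_isBasis_of_subset (hI.subset.trans hG) G.2.subset_ground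
  choose J hJ hIJ using hJ
  -- A flat of full rank is the ground set, and nothing else lies above it.
  by_cases hFk : natRank M F.1 < k
  swap
  · refine ⟨fun _ => top, fun G hG H hH _ => ?_, fun G hG => ⟨Set.subset_univ _, ?_⟩⟩
    · have hF := htop hFk
      exact Subtype.ext ((G.2.subset_ground.antisymm (hF ▸ hG)).trans
        (H.2.subset_ground.antisymm (hF ▸ hH)).symm)
    · have := natRank_mono (M := M) (show F.1 ⊆ G.1 from hG)
      have := hle G
      change natRank _ Set.univ = _
      omega
  have hF'r : F'.1.ncard = natRank M F.1 := by
    rw [hr]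
    exact ncard_eq_natRank (hr ▸ hFk)
  have : Nonempty (Fin n) := ⟨⟨0, by omega⟩⟩
  have hfin : (M.E \ I).Finite := M.ground_finite.sdiff
  obtain ⟨θ, hθ, hinj⟩ : ∃ θ : α → Fin n, M.E \ I ⊆ θ ⁻¹' F'.1ᶜ ∧ Set.InjOn θ (M.E \ I) := by
    refine hfin.exists_injOn_of_encard_le ?_
    rw [← hfin.cast_ncard_eq, ← (Set.toFinite F'.1ᶜ).cast_ncard_eq, Nat.cast_le,
      Set.ncard_sdiff hI.indep.subset_ground (M.ground_finite.subset hI.indep.subset_ground),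
      Set.ncard_compl, hn, hIr, hF'r, Nat.card_fin]
  have hsub {G : Flats M} (hG : F ≤ G) : J G hG \ I ⊆ M.E \ I :=
    Set.sdiff_subset_sdiff_left (hJ G hG).indep.subset_ground
  have hdisj {G : Flats M} (hG : F ≤ G) : Disjoint F'.1 (θ '' (J G hG \ I)) := by
    rw [Set.disjoint_right]
    rintro _ ⟨e, he, rfl⟩
    exact hθ (hsub hG he)
  have hcard {G : Flats M} (hG : F ≤ G) :
      (F'.1 ∪ θ '' (J G hG \ I)).ncard = natRank M G.1 := by
    have hJfin : (J G hG).Finite := M.ground_finite.subset (hJ G hG).indep.subset_ground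
    have hJr : (J G hG).ncard = natRank M G.1 := by
      rw [natRank, (hJ G hG).eRk_eq_encard, Set.ncard]
    have := Set.ncard_le_ncard (hIJ G hG) hJfin
    rw [Set.ncard_union_eq (hdisj hG) (Set.toFinite _) (Set.toFinite _),
      (hinj.mono (hsub hG)).ncard_image,
      Set.ncard_sdiff (hIJ G hG) (hJfin.subset (hIJ G hG))]
    omega
  let φ : Flats M → Flats (Matroid.uniform k n) := fun G =>
    if h : F ≤ G ∧ natRank M G.1 < k then
      ⟨F'.1 ∪ θ '' (J G h.1 \ I), isFlat_uniform_of_ncard_lt ((hcard h.1).trans_lt h.2)⟩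
    else top
  have hφ {G : Flats M} (hG : F ≤ G) (hGk : natRank M G.1 < k) :
      (φ G).1 = F'.1 ∪ θ '' (J G hG \ I) := by
    simp only [φ, dif_pos (And.intro hG hGk)]
  have hφtop {G : Flats M} (hGk : ¬ natRank M G.1 < k) : φ G = top :=
    dif_neg fun h => hGk h.2
  have hrank {G : Flats M} (hG : F ≤ G) :
      natRank (Matroid.uniform k n) (φ G).1 = natRank M G.1 := by
    by_cases hGk : natRank M G.1 < k
    · rw [hφ hG hGk, natRank_uniform_of_ncard_le ((hcard hG).trans_le hGk.le), hcard hG]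
    · rw [hφtop hGk, htop hGk, hME]
      exact hUE
  refine ⟨φ, fun G hG H hH hGH => ?_, fun G hG => ⟨?_, hrank hG⟩⟩
  · have hGHr : natRank M G.1 = natRank M H.1 := by rw [← hrank hG, ← hrank hH, hGH]
    by_cases hGk : natRank M G.1 < k
    · have hHk : natRank M H.1 < k := hGHr ▸ hGk
      have himage : θ '' (J G hG \ I) = θ '' (J H hH \ I) := by
        have h1 := congrArg (fun X => X.1 \ F'.1) hGH
        simp only [hφ hG hGk, hφ hH hHk, Set.union_sdiff_left] at h1
        rwa [(hdisj hG).symm.sdiff_eq_left, (hdisj hH).symm.sdiff_eq_left] at h1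
      have hdiff := (hinj.image_eq_image_iff (hsub hG) (hsub hH)).1 himage
      have hJJ : J G hG = J H hH := by
        rw [← Set.sdiff_union_of_subset (hIJ G hG), hdiff, Set.sdiff_union_of_subset (hIJ H hH)]
      refine Subtype.ext ?_
      rw [← G.2.closure, ← H.2.closure, ← (hJ G hG).closure_eq_closure,
        ← (hJ H hH).closure_eq_closure, hJJ]
    · exact Subtype.ext ((htop hGk).trans (htop (hGHr ▸ hGk)).symm)
  · by_cases hGk : natRank M G.1 < k
    · change F'.1 ⊆ (φ G).1
      rw [hφ hG hGk]
      exact Set.subset_union_left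
    · rw [hφtop hGk]
      exact Set.subset_univ F'.1

/-- The elements above the added bottom are all flats, that is, the flats above the set of loops. -/
theorem exists_injOn_withBot (hk : M.eRank = (k : ℕ∞)) (hn : M.E.ncard = n)
    (F : WithBot (Flats M)) (F' : WithBot (Flats (Matroid.uniform k n)))
    (hr : botRank M F = botRank (Matroid.uniform k n) F') :
    ∃ φ : WithBot (Flats M) → WithBot (Flats (Matroid.uniform k n)),
      Set.InjOn φ (Set.Ioi F) ∧
        ∀ G, F < G → F' < φ G ∧ botRank (Matroid.uniform k n) (φ G) = botRank M G := by
  have hlift {φ : Flats M → Flats (Matroid.uniform k n)} {s : Set (Flats M)}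
      (h : Set.InjOn φ s) (hs : ∀ G : Flats M, F < G → G ∈ s) :
      Set.InjOn (WithBot.map φ) (Set.Ioi F) := by
    intro G hG H hH hGH
    induction G with
    | bot => exact (not_lt_bot (Set.mem_Ioi.1 hG)).elim
    | coe G =>
    induction H with
    | bot => exact (not_lt_bot (Set.mem_Ioi.1 hH)).elim
    | coe H => exact congrArg _ (h (hs G hG) (hs H hH) (WithBot.coe_injective hGH))
  induction F with
  | bot =>
    induction F' with
    | coe F' => simp at hr
    | bot =>
    obtain ⟨φ, hinj, hφ⟩ := exists_injOn_flats hk hn ⟨M.closure ∅, M.isFlat_closure ∅⟩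
      ⟨(Matroid.uniform k n).closure ∅, (Matroid.uniform k n).isFlat_closure ∅⟩
      (by simp [natRank_closure, natRank_empty])
    have hle (G : Flats M) : ⟨M.closure ∅, M.isFlat_closure ∅⟩ ≤ G :=
      WithBot.coe_le_coe.1 (loopFlat_le G)
    refine ⟨WithBot.map φ, hlift hinj fun G _ => hle G, fun G hG => ?_⟩
    induction G with
    | bot => exact (not_lt_bot hG).elim
    | coe G =>
      rw [WithBot.map_coe]
      exact ⟨WithBot.bot_lt_coe _, by simpa using (hφ G (hle G)).2⟩
  | coe F =>
    induction F' with
    | bot => simp at hr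
    | coe F' =>
    obtain ⟨φ, hinj, hφ⟩ := exists_injOn_flats hk hn F F' (by simpa using hr)
    refine ⟨WithBot.map φ, hlift hinj fun G hG => (WithBot.coe_lt_coe.1 hG).le, fun G hG => ?_⟩
    induction G with
    | bot => exact (not_lt_bot hG).elim
    | coe G =>
      have hFG : F < G := WithBot.coe_lt_coe.1 hG
      obtain ⟨h1, h2⟩ := hφ G hFG.le
      rw [WithBot.map_coe]
      refine ⟨WithBot.coe_lt_coe.2 (lt_of_le_of_ne h1 ?_), by simpa using h2⟩
      rintro rfl
      exact hFG.ne (Subtype.ext (eq_of_natRank_le F.2 G.2 hFG.le (by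
        have : natRank M F.1 = natRank (Matroid.uniform k n) (φ G).1 := by simpa using hr
        omega)))

theorem loopless_uniform [M.Loopless] (hk : M.eRank = (k : ℕ∞)) (hn : M.E.ncard = n) :
    (Matroid.uniform k n).Loopless := by
  refine ⟨?_⟩
  rw [Matroid.loops]
  rcases Nat.eq_zero_or_pos k with rfl | hpos
  -- In rank zero the smallest flat is the ground set, so a loopless matroid has no elements.
  · have hE : M.closure ∅ = M.E := by
      refine eq_of_natRank_le (M.isFlat_closure ∅) M.ground_isFlat (M.closure_subset_ground ∅) ?_
      rw [natRank, M.eRk_ground, hk]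
      simp
    rw [closure_empty_eq_empty] at hE
    rw [← hE, Set.ncard_empty] at hn
    subst hn
    exact Set.eq_empty_of_isEmpty _
  · exact (isFlat_uniform_of_ncard_lt (by simpa using hpos)).closure

end Uniform

end ChowBasis

theorem mainTheorem4 {α : Type*} (M : Matroid α) [M.Finite] [M.Loopless] (k n : ℕ)
    (hk : M.eRank = (k : ℕ∞)) (hn : M.E.ncard = n) :
    Matroid.CoeffLE M.chowSeries (Matroid.uniform k n).chowSeries ∧
      Matroid.CoeffLE M.augChowSeries (Matroid.uniform k n).augChowSeries := by
  have := ChowBasis.loopless_uniform hk hn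
  have key := ChowBasis.coeff_fyPoly_le (ChowBasis.exists_injOn_withBot hk hn)
  constructor
  · intro j
    rw [map_sub, ChowBasis.chowSeries_eq, ChowBasis.chowSeries_eq, sub_nonneg, Nat.cast_le]
    exact key _ _ (by rw [ChowBasis.botRank_loopFlat, ChowBasis.botRank_loopFlat]) j
  · intro j
    rw [map_sub, ChowBasis.augChowSeries_eq, ChowBasis.augChowSeries_eq, sub_nonneg, Nat.cast_le]
    exact key _ _ rfl j
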